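/- Fix a countably infinite set $\mathrm{Var}$ of variables. A many-sorted signature $\mathcal{L}$ consists of: relation symbols and function symbols, each with an arity $n\ge 0$; a nonempty set $\mathrm{Sort}$ of sorts; pairwise disjoint infinite sets $\mathrm{Var}_i\subseteq\mathrm{Var}$ of variables of sort $i$, one for each $i\in\mathrm{Sort}$; for each $n$-ary relation symbol $R$ a nonempty set $\mathrm{rank}(R)\subseteq\mathrm{Sort}^n$; and for each $n$-ary function symbol $f$ a nonempty partial function $\mathrm{rank}(f)$ from $\mathrm{Sort}^n$ to $\mathrm{Sort}$. A variable $x\in\mathrm{Var}_i$ is a well-sorted term of sort $i$, and $f(t_1,\dots,t_n)$ is a well-sorted term of sort $i$ if $t_1,\dots,t_n$ are well-sorted terms of sorts $i_1,\dots,i_n$ with $\mathrm{rank}(f)(i_1,\dots,i_n)=i$. Well-sorted formulas are built from $\bot$, equations $t_1=t_2$ between well-sorted terms of the same sort, and atoms $R(t_1,\dots,t_n)$ where $t_1,\dots,t_n$ are well-sorted terms of sorts $i_1,\dots,i_n$ with $(i_1,\dots,i_n)\in\mathrm{rank}(R)$, by means of $\land,\lor,\to$ and the quantifiers $\forall x^i,\exists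 x^i$ over variables $x^i\in\mathrm{Var}_i$, $i\in\mathrm{Sort}$. An $\mathcal{L}$-sentence is a well-sorted formula without free variables. $\Pi\vdash_{\mathrm{FOL}}A$ denotes derivability in natural deduction for unsorted first-order logic from $\Pi$ together with the universal closures of the equality axioms (reflexivity, symmetry, transitivity, congruence for all relation and function symbols). $\Gamma\vdash_{\mathrm{MSL}}\varphi$ denotes derivability from $\Gamma$ by natural deduction derivations that consist of well-sorted formulas and in which $\forall$-elimination and $\exists$-introduction replace a variable by a term of the same sort, together with the universal closures of the well-sorted equality axioms (reflexivity, symmetry and transitivity for variables of one sort; congruence for $R$ at each $(i_1,\dots,i_n)\in\mathrm{rank}(R)$ and for $f$ at each $(i_1,\dots,i_n)\in\mathrm{dom}(\mathrm{rank}(f))$). Let $\mathcal{L}^*$ be the unsorted signature with the relation and function symbols of $\mathcal{L}$ and a fresh unary relation symbol $Q_i$ for each $i\in\mathrm{Sort}$. The translation $\varphi\mapsto\varphi^*$ leaves atomic formulas unchanged, commutes with $\land,\lor,\to$, and satisfies $(\forall x^i\varphi)^*=\forall x(Q_ix\to\varphi^*)$ and $(\exists x^i\varphi)^*=\exists x(Q_ix\land\varphi^*)$;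 put $\Gamma^*=\{\psi^*:\psi\in\Gamma\}$. Let $J$ be the set of universal closures of the formulas $\exists x\,Q_ix$ for $i\in\mathrm{Sort}$ and $Q_{i_1}x_1\land\dots\land Q_{i_n}x_n\to Q_if(x_1,\dots,x_n)$ for each function symbol $f$ and all sorts with $\mathrm{rank}(f)(i_1,\dots,i_n)=i$. **Theorem.** Let $\mathcal{L}$ be a many-sorted signature and let $\Gamma\cup\{\varphi\}$ be any set of $\mathcal{L}$-sentences. Then $$\Gamma\vdash_{\mathrm{MSL}}\varphi\quad\text{if and only if}\quad\Gamma^*,J\vdash_{\mathrm{FOL}}\varphi^*.$$ This holds both when $\vdash_{\mathrm{MSL}}$ and $\vdash_{\mathrm{FOL}}$ are the classical calculi and when both are the intuitionistic calculi, obtained by removing the rule of reductio ad absurdum. -/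

import Mathlib

/-! Unsorted and many-sorted first-order logic with equality over named variables `ℕ`, the natural
deduction calculi (classical and intuitionistic), and the relativizing translation.

An unsorted signature is given by the families `F n` of `n`-ary function symbols and `R n` of
`n`-ary relation symbols (`n ≥ 0`). -/

namespace ManySorted

universe u v w

/-- Unsorted terms; the variables are the natural numbers. -/
inductive Term (F : ℕ → Type u) : Type u
  | var (x : ℕ) : Term F
  | app {n : ℕ} (f : F n) (ts : Fin n → Term F) : Term F

/-- Unsorted formulas, with all connectives and both quantifiers primitive. -/
inductive Formula (F : ℕ → Type u) (R : ℕ → Type v) : Type (max u v)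
  | bot : Formula F R
  | eq (s t : Term F) : Formula F R
  | rel {n : ℕ} (r : R n) (ts : Fin n → Term F) : Formula F R
  | and (A B : Formula F R) : Formula F R
  | or (A B : Formula F R) : Formula F R
  | imp (A B : Formula F R) : Formula F R
  | all (x : ℕ) (A : Formula F R) : Formula F R
  | ex (x : ℕ) (A : Formula F R) : Formula F R

namespace Term

variable {F : ℕ → Type u}

/-- The variables occurring in a term. -/
def vars : Term F → Finset ℕ
  | var x => {x}
  | app _ ts => Finset.univ.biUnion fun k => (ts k).vars

/-- `s.subst x t` is `s[t/x]`. -/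
def subst : Term F → ℕ → Term F → Term F
  | var y, x, t => if y = x then t else var y
  | app f ts, x, t => app f fun k => (ts k).subst x t

end Term

namespace Formula

variable {F : ℕ → Type u} {R : ℕ → Type v}

/-- The free variables of a formula. -/
def fv : Formula F R → Finset ℕ
  | bot => ∅
  | eq s t => s.vars ∪ t.vars
  | rel _ ts => Finset.univ.biUnion fun k => (ts k).vars
  | and A B => A.fv ∪ B.fv
  | or A B => A.fv ∪ B.fv
  | imp A B => A.fv ∪ B.fv
  | all x A => A.fv.erase x
  | ex x A => A.fv.erase x

/-- `A.subst x t` replaces each free occurrence of `x` in `A` by `t`. It is used only when `t` is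
free for `x` in `A`. -/
def subst (x : ℕ) (t : Term F) : Formula F R → Formula F R
  | bot => bot
  | eq s s' => eq (s.subst x t) (s'.subst x t)
  | rel r ts => rel r fun k => (ts k).subst x t
  | and A B => and (A.subst x t) (B.subst x t)
  | or A B => or (A.subst x t) (B.subst x t)
  | imp A B => imp (A.subst x t) (B.subst x t)
  | all y A => if y = x then all y A else all y (A.subst x t)
  | ex y A => if y = x then ex y A else ex y (A.subst x t)

/-- `A.FreeFor x t`: the term `t` is free for `x` in `A`, that is, no free occurrence of `x` in `A`
lies in the scope of a quantifier binding a variable of `t`. -/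
def FreeFor (x : ℕ) (t : Term F) : Formula F R → Prop
  | bot => True
  | eq _ _ => True
  | rel _ _ => True
  | and A B => A.FreeFor x t ∧ B.FreeFor x t
  | or A B => A.FreeFor x t ∧ B.FreeFor x t
  | imp A B => A.FreeFor x t ∧ B.FreeFor x t
  | all y A => x ∈ (all y A).fv → y ∉ t.vars ∧ A.FreeFor x t
  | ex y A => x ∈ (ex y A).fv → y ∉ t.vars ∧ A.FreeFor x t

/-- Negation `A → ⊥`. -/
def neg (A : Formula F R) : Formula F R := imp A bot

/-- Truth `⊥ → ⊥`. -/
def top : Formula F R := imp bot bot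

/-- The conjunction of a list of formulas; the empty conjunction is `⊤`. -/
def conj : List (Formula F R) → Formula F R
  | [] => top
  | [A] => A
  | A :: B :: l => and A (conj (B :: l))

/-- `A 0 ∧ … ∧ A (n - 1)`. -/
def bigAnd {n : ℕ} (A : Fin n → Formula F R) : Formula F R := conj (List.ofFn A)

/-- The universal closure: all free variables are quantified, in increasing order. -/
def univClosure (A : Formula F R) : Formula F R := (A.fv.sort (· ≤ ·)).foldr all A

end Formula

open Formula

/-- The two versions of the calculi. -/
inductive Mode
  | classical
  | intuitionistic

/-- Natural deduction. `Derives m W T Γ A` says that there is a derivation of `A` whose undischarged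
assumptions lie in `Γ`, in which all formulas satisfy `W`, and in which the quantifier rules
instantiate `x` by `t` only if `T x t`. Reductio ad absurdum is available in classical mode only. -/
inductive Derives {F : ℕ → Type u} {R : ℕ → Type v} (m : Mode)
    (W : Formula F R → Prop) (T : ℕ → Term F → Prop) :
    Set (Formula F R) → Formula F R → Prop
  | assumption {Γ A} (hA : A ∈ Γ) (hW : W A) : Derives m W T Γ A
  | weaken {Γ Δ A} (h : Γ ⊆ Δ) (d : Derives m W T Γ A) : Derives m W T Δ A
  | andI {Γ A B} (d₁ : Derives m W T Γ A) (d₂ : Derives m W T Γ B) : Derives m W T Γ (and A B)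
  | andE₁ {Γ A B} (d : Derives m W T Γ (and A B)) : Derives m W T Γ A
  | andE₂ {Γ A B} (d : Derives m W T Γ (and A B)) : Derives m W T Γ B
  | orI₁ {Γ A B} (hB : W B) (d : Derives m W T Γ A) : Derives m W T Γ (or A B)
  | orI₂ {Γ A B} (hA : W A) (d : Derives m W T Γ B) : Derives m W T Γ (or A B)
  | orE {Γ A B C} (d : Derives m W T Γ (or A B)) (d₁ : Derives m W T (insert A Γ) C)
      (d₂ : Derives m W T (insert B Γ) C) : Derives m W T Γ C
  | impI {Γ A B} (hA : W A) (d : Derives m W T (insert A Γ) B) : Derives m W T Γ (imp A B)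
  | impE {Γ A B} (d₁ : Derives m W T Γ (imp A B)) (d₂ : Derives m W T Γ A) : Derives m W T Γ B
  | botE {Γ A} (hA : W A) (d : Derives m W T Γ bot) : Derives m W T Γ A
  | raa {Γ A} (hm : m = Mode.classical) (hA : W A) (d : Derives m W T (insert (neg A) Γ) bot) :
      Derives m W T Γ A
  | allI {Γ x A} (hW : W (all x A)) (hx : ∀ B ∈ Γ, x ∉ B.fv) (d : Derives m W T Γ A) :
      Derives m W T Γ (all x A)
  | allE {Γ x A t} (ht : T x t) (hf : A.FreeFor x t) (d : Derives m W T Γ (all x A)) :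
      Derives m W T Γ (A.subst x t)
  | exI {Γ x A t} (hW : W (ex x A)) (ht : T x t) (hf : A.FreeFor x t)
      (d : Derives m W T Γ (A.subst x t)) : Derives m W T Γ (ex x A)
  | exE {Γ x A C} (hx : ∀ B ∈ Γ, x ∉ B.fv) (hC : x ∉ C.fv) (d : Derives m W T Γ (ex x A))
      (d₁ : Derives m W T (insert A Γ) C) : Derives m W T Γ C

/-- The equality axioms of unsorted logic, before universal closure; the variables are arbitrary. -/
inductive FOLEqAxiom {F : ℕ → Type u} {R : ℕ → Type v} : Formula F R → Prop
  | refl (x : ℕ) : FOLEqAxiom (eq (.var x) (.var x))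
  | symm (x y : ℕ) : FOLEqAxiom (imp (eq (.var x) (.var y)) (eq (.var y) (.var x)))
  | trans (x y z : ℕ) : FOLEqAxiom
      (imp (and (eq (.var x) (.var y)) (eq (.var y) (.var z))) (eq (.var x) (.var z)))
  | relCongr {n : ℕ} (r : R n) (x y : Fin n → ℕ) : FOLEqAxiom
      (imp (bigAnd fun k => eq (.var (x k)) (.var (y k)))
        (imp (rel r fun k => .var (x k)) (rel r fun k => .var (y k))))
  | funCongr {n : ℕ} (f : F n) (x y : Fin n → ℕ) : FOLEqAxiom
      (imp (bigAnd fun k => eq (.var (x k)) (.var (y k)))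
        (eq (.app f fun k => .var (x k)) (.app f fun k => .var (y k))))

/-- `Δ ⊢_FOL A`, in classical or intuitionistic logic. -/
def FOLProves {F : ℕ → Type u} {R : ℕ → Type v} (m : Mode) (Δ : Set (Formula F R))
    (A : Formula F R) : Prop :=
  Derives m (fun _ => True) (fun _ _ => True) (Δ ∪ univClosure '' {B | FOLEqAxiom B}) A

/-- A many-sorted signature. The pairwise disjoint sets `Var_i` of variables are given by the
partial function `varSort`, with `Var_i = {x | varSort x = some i}`. -/
structure Signature : Type (max (u + 1) (v + 1) (w + 1)) where
  /-- The function symbols of each arity. -/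
  Fun : ℕ → Type u
  /-- The relation symbols of each arity. -/
  Rel : ℕ → Type v
  /-- The sorts. -/
  Srt : Type w
  srt_nonempty : Nonempty Srt
  varSort : ℕ → Option Srt
  var_infinite : ∀ i : Srt, {x : ℕ | varSort x = some i}.Infinite
  /-- The admissible combinations of argument sorts of a relation symbol. -/
  relRank : ∀ {n : ℕ}, Rel n → Set (Fin n → Srt)
  relRank_nonempty : ∀ {n : ℕ} (r : Rel n), (relRank r).Nonempty
  /-- The partial function giving the value sort for each admissible combination of argument
  sorts of a function symbol. -/
  funRank : ∀ {n : ℕ}, Fun n → (Fin n → Srt) → Option Srt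
  funRank_nonempty : ∀ {n : ℕ} (f : Fun n), ∃ a i, funRank f a = some i

/-- The relation symbols of the unsorted target signature: those of the many-sorted signature and a
fresh unary sort predicate `Q i` for each sort `i`. -/
inductive StarRel (R : ℕ → Type v) (S : Type w) : ℕ → Type (max v w)
  | old {n : ℕ} (r : R n) : StarRel R S n
  | Q (i : S) : StarRel R S 1

namespace Signature

variable (L : Signature.{u, v, w})

/-- `L.HasSort t i`: the term `t` is well sorted, of sort `i`. -/
inductive HasSort : Term L.Fun → L.Srt → Prop
  | var {x : ℕ} {i : L.Srt} (h : L.varSort x = some i) : HasSort (.var x) i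
  | app {n : ℕ} {f : L.Fun n} {ts : Fin n → Term L.Fun} {a : Fin n → L.Srt} {i : L.Srt}
      (hts : ∀ k, HasSort (ts k) (a k)) (h : L.funRank f a = some i) : HasSort (.app f ts) i

/-- Well-sorted formulas. -/
def WellSorted : Formula L.Fun L.Rel → Prop
  | .bot => True
  | .eq s t => ∃ i, L.HasSort s i ∧ L.HasSort t i
  | .rel r ts => ∃ a ∈ L.relRank r, ∀ k, L.HasSort (ts k) (a k)
  | .and A B => WellSorted A ∧ WellSorted B
  | .or A B => WellSorted A ∧ WellSorted B
  | .imp A B => WellSorted A ∧ WellSorted B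
  | .all x A => (∃ i, L.varSort x = some i) ∧ WellSorted A
  | .ex x A => (∃ i, L.varSort x = some i) ∧ WellSorted A

/-- Well-sorted sentences. -/
def IsSentence (A : Formula L.Fun L.Rel) : Prop := L.WellSorted A ∧ A.fv = ∅

/-- The equality axioms of many-sorted logic, before universal closure. -/
inductive EqAxiom : Formula L.Fun L.Rel → Prop
  | refl {i : L.Srt} (x : ℕ) (hx : L.varSort x = some i) : EqAxiom (eq (.var x) (.var x))
  | symm {i : L.Srt} (x y : ℕ) (hx : L.varSort x = some i) (hy : L.varSort y = some i) :
      EqAxiom (imp (eq (.var x) (.var y)) (eq (.var y) (.var x)))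
  | trans {i : L.Srt} (x y z : ℕ) (hx : L.varSort x = some i) (hy : L.varSort y = some i)
      (hz : L.varSort z = some i) : EqAxiom
      (imp (and (eq (.var x) (.var y)) (eq (.var y) (.var z))) (eq (.var x) (.var z)))
  | relCongr {n : ℕ} (r : L.Rel n) (a : Fin n → L.Srt) (ha : a ∈ L.relRank r) (x y : Fin n → ℕ)
      (hx : ∀ k, L.varSort (x k) = some (a k)) (hy : ∀ k, L.varSort (y k) = some (a k)) : EqAxiom
      (imp (bigAnd fun k => eq (.var (x k)) (.var (y k)))
        (imp (rel r fun k => .var (x k)) (rel r fun k => .var (y k))))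
  | funCongr {n : ℕ} (f : L.Fun n) (a : Fin n → L.Srt) (i : L.Srt) (ha : L.funRank f a = some i)
      (x y : Fin n → ℕ)
      (hx : ∀ k, L.varSort (x k) = some (a k)) (hy : ∀ k, L.varSort (y k) = some (a k)) : EqAxiom
      (imp (bigAnd fun k => eq (.var (x k)) (.var (y k)))
        (eq (.app f fun k => .var (x k)) (.app f fun k => .var (y k))))

/-- `Γ ⊢_MSL A`: derivability by derivations consisting of well-sorted formulas in which variables
are instantiated by terms of the same sort. -/
def MSLProves (m : Mode) (Γ : Set (Formula L.Fun L.Rel)) (A : Formula L.Fun L.Rel) : Prop :=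
  Derives m L.WellSorted (fun x t => ∃ i, L.varSort x = some i ∧ L.HasSort t i)
    (Γ ∪ univClosure '' {B | L.EqAxiom B}) A

/-- Formulas over the unsorted target signature. -/
abbrev StarFormula := Formula L.Fun (StarRel L.Rel L.Srt)

/-- The atomic formula `Q_i t`. -/
def sortPred (i : L.Srt) (t : Term L.Fun) : L.StarFormula := .rel (.Q i) fun _ => t

/-- The translation: quantifiers over variables of sort `i` are relativized to `Q i`. The clauses
for quantified variables without a sort do not concern well-sorted formulas. -/
def star : Formula L.Fun L.Rel → L.StarFormula
  | .bot => .bot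
  | .eq s t => .eq s t
  | .rel r ts => .rel (.old r) ts
  | .and A B => .and (star A) (star B)
  | .or A B => .or (star A) (star B)
  | .imp A B => .imp (star A) (star B)
  | .all x A =>
      match L.varSort x with
      | some i => .all x (.imp (L.sortPred i (.var x)) (star A))
      | none => .all x (star A)
  | .ex x A =>
      match L.varSort x with
      | some i => .ex x (.and (L.sortPred i (.var x)) (star A))
      | none => .ex x (star A)

/-- The sort axioms, before universal closure: every sort is nonempty, and the function symbols
respect their ranks. -/
inductive SortAxiom : L.StarFormula → Prop
  | nonempty (i : L.Srt) (x : ℕ) : SortAxiom (ex x (L.sortPred i (.var x)))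
  | rank {n : ℕ} (f : L.Fun n) (a : Fin n → L.Srt) (i : L.Srt) (h : L.funRank f a = some i)
      (x : Fin n → ℕ) : SortAxiom
      (imp (bigAnd fun k => L.sortPred (a k) (.var (x k)))
        (L.sortPred i (.app f fun k => .var (x k))))

/-- The set `J` of sort axioms. -/
def J : Set L.StarFormula := univClosure '' {B | L.SortAxiom B}

end Signature

end ManySorted

/-! From left to right, a many-sorted derivation is translated rule by rule. A variable of sort `i`
carries the hypothesis `Q_i x`; the rank axioms in `J` then give `Q_i t` for every well-sorted term
`t` of sort `i`, which is what the relativized quantifier rules require. A translated derivation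
uses sort hypotheses for finitely many variables. Since the premises and the conclusion are
sentences, these are discharged at the end by existential elimination on the axioms `∃ x, Q_i x`.
The translated equality axioms are weaker than the unsorted ones. This is `Proves.star` followed by
`derives_of_sortHyps`.

From right to left, a Kripke-Beth style model of the unsorted theory is built from many-sorted
derivability. Worlds are sets of many-sorted formulas, ordered by inclusion and restricted to
finitely many free variables so that fresh variables always exist. The domain is the set of all
terms, because unsorted rules may instantiate by ill-sorted ones. `Q_i t` holds when `t` has sort
`i`, well-sorted atoms hold when derivable, and all ill-sorted terms are identified. Disjunction and
existence are interpreted through `Closure`, which refers only to derivability of well-sorted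
formulas, so no prime or Henkin extension is constructed. Every forced formula is stable under this
closure (`Force.of_closure`), hence unsorted natural deduction is sound (`Force.sound`). If the
many-sorted calculus has reductio, stability also validates unsorted reductio, so both modes are
treated at once. The equality axioms and `J` are forced, and forcing the translation of a
well-sorted formula amounts to deriving it (`Force.star_iff`). Evaluation at the world consisting of
`Γ` and the equality axioms finishes the proof.

Substitution in the calculus is not capture-avoiding. The model needs arbitrary simultaneous
substitutions, so these are handled by the relation `Inst`, whose results are interderivable
(`Inst.proves`). -/

namespace ManySorted

universe u v w

open Formula Function

/-! ### Substitution in terms and formulas -/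

namespace Term

variable {F : ℕ → Type u}

/-- Simultaneous substitution. -/
def bind (ρ : ℕ → Term F) : Term F → Term F
  | var x => ρ x
  | app f ts => app f fun k => (ts k).bind ρ

theorem bind_congr {ρ σ : ℕ → Term F} {s : Term F} (h : ∀ x ∈ s.vars, ρ x = σ x) :
    s.bind ρ = s.bind σ := by
  induction s with
  | var x => exact h x (by simp [vars])
  | app f ts ih =>
    simp only [bind, app.injEq, heq_eq_eq, true_and]
    funext k
    exact ih k fun x hx => h x (by simp only [vars, Finset.mem_biUnion]; exact ⟨k, by simp, hx⟩)

@[simp] theorem bind_var (s : Term F) : s.bind var = s := by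
  induction s with
  | var x => rfl
  | app f ts ih => simp [bind, ih]

theorem bind_bind (ρ σ : ℕ → Term F) (s : Term F) :
    (s.bind ρ).bind σ = s.bind fun x => (ρ x).bind σ := by
  induction s with
  | var x => rfl
  | app f ts ih => simp [bind, ih]

theorem subst_eq_bind (s : Term F) (x : ℕ) (t : Term F) : s.subst x t = s.bind (update var x t) := by
  induction s with
  | var y => simp [subst, bind, update_apply]
  | app f ts ih => simp [subst, bind, ih]

theorem mem_vars_bind {ρ : ℕ → Term F} {s : Term F} {x : ℕ} :
    x ∈ (s.bind ρ).vars ↔ ∃ y ∈ s.vars, x ∈ (ρ y).vars := by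
  induction s with
  | var y => simp [bind, vars]
  | app f ts ih =>
    simp only [bind, vars, Finset.mem_biUnion, Finset.mem_univ, true_and, ih]
    constructor
    · rintro ⟨k, y, hy, hx⟩
      exact ⟨y, ⟨k, hy⟩, hx⟩
    · rintro ⟨y, ⟨k, hy⟩, hx⟩
      exact ⟨k, y, hy, hx⟩

theorem subst_of_notMem {s : Term F} {x : ℕ} {t : Term F} (h : x ∉ s.vars) : s.subst x t = s := by
  rw [subst_eq_bind]
  conv_rhs => rw [← bind_var s]
  exact bind_congr fun y hy => update_of_ne (fun e : y = x => h (e ▸ hy)) _ _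

@[simp] theorem subst_self (s : Term F) (x : ℕ) : s.subst x (var x) = s := by
  rw [subst_eq_bind, update_eq_self, bind_var]

theorem bind_subst (ρ : ℕ → Term F) (s : Term F) (x : ℕ) (t : Term F) :
    (s.bind ρ).subst x t = s.bind fun y => (ρ y).subst x t := by
  simp only [subst_eq_bind, bind_bind]

theorem subst_bind (ρ : ℕ → Term F) (s : Term F) (x : ℕ) (t : Term F) :
    (s.subst x t).bind ρ = s.bind (update ρ x (t.bind ρ)) := by
  rw [subst_eq_bind, bind_bind]
  refine bind_congr fun y _ => ?_
  by_cases h : y = x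
  · subst h; simp
  · simp [h, bind]

theorem mem_vars_subst {s t : Term F} {x y : ℕ} (h : y ∈ (s.subst x t).vars) :
    y ∈ s.vars ∨ y ∈ t.vars := by
  rw [subst_eq_bind, mem_vars_bind] at h
  obtain ⟨z, hz, hy⟩ := h
  by_cases e : z = x
  · subst e; simp at hy; exact .inr hy
  · simp [e, vars] at hy; subst hy; exact .inl hz

end Term

namespace Formula

variable {F : ℕ → Type u} {R : ℕ → Type v}

theorem subst_of_notMem {A : Formula F R} {x : ℕ} {t : Term F} (h : x ∉ A.fv) :
    A.subst x t = A := by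
  induction A with
  | bot => rfl
  | eq s s' =>
    simp only [fv, Finset.mem_union, not_or] at h
    simp [subst, Term.subst_of_notMem h.1, Term.subst_of_notMem h.2]
  | rel r ts =>
    simp only [fv, Finset.mem_biUnion, Finset.mem_univ, true_and, not_exists] at h
    simp [subst, fun k => Term.subst_of_notMem (t := t) (h k)]
  | and A B ihA ihB | or A B ihA ihB | imp A B ihA ihB =>
    simp only [fv, Finset.mem_union, not_or] at h
    simp [subst, ihA h.1, ihB h.2]
  | all y A ih | ex y A ih =>
    simp only [fv, Finset.mem_erase, not_and] at h
    by_cases e : y = x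
    · simp [subst, e]
    · simp [subst, e, ih (h (Ne.symm e))]

@[simp] theorem subst_self (A : Formula F R) (x : ℕ) : A.subst x (.var x) = A := by
  induction A with
  | bot => rfl
  | eq s s' => simp [subst]
  | rel r ts => simp [subst]
  | and A B ihA ihB | or A B ihA ihB | imp A B ihA ihB => simp [subst, ihA, ihB]
  | all y A ih | ex y A ih => simp [subst, ih]

theorem freeFor_self (A : Formula F R) (x : ℕ) : A.FreeFor x (.var x) := by
  induction A with
  | bot | eq | rel => trivial
  | and A B ihA ihB | or A B ihA ihB | imp A B ihA ihB => exact ⟨ihA, ihB⟩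
  | all y A ih | ex y A ih =>
    intro h
    refine ⟨?_, ih⟩
    simp only [fv, Finset.mem_erase] at h
    simpa [Term.vars] using Ne.symm h.1

theorem fv_foldr_all (l : List ℕ) (A : Formula F R) (x : ℕ) :
    x ∈ (l.foldr all A).fv ↔ x ∈ A.fv ∧ x ∉ l := by
  induction l with
  | nil => simp
  | cons y l ih => simp [fv, ih]; tauto

@[simp] theorem fv_univClosure (A : Formula F R) : A.univClosure.fv = ∅ := by
  ext x
  simp [univClosure, fv_foldr_all]

theorem bigAnd_eq {n : ℕ} (A : Fin n → Formula F R) :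
    bigAnd A = conj ((List.finRange n).map A) := by
  rw [bigAnd, List.ofFn_eq_map]

end Formula

/-! ### Derived rules of natural deduction -/

namespace Derives

variable {F : ℕ → Type u} {R : ℕ → Type v} {m : Mode} {W : Formula F R → Prop}
  {T : ℕ → Term F → Prop} {Γ : Set (Formula F R)}

theorem cut {A B : Formula F R} (hA : W A) (d : Derives m W T {A} B) (h : Derives m W T Γ A) :
    Derives m W T Γ B :=
  .impE (.impI hA (.weaken (by simp) d)) h

theorem top (h : W Formula.bot) : Derives m W T Γ Formula.top :=
  .impI h (.assumption (by simp) h)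

theorem conj (h : W Formula.bot) : ∀ {l : List (Formula F R)},
    (∀ A ∈ l, Derives m W T Γ A) → Derives m W T Γ (Formula.conj l)
  | [], _ => top h
  | [A], hl => hl A (by simp)
  | A :: B :: l, hl => .andI (hl A (by simp)) (conj h fun C hC => hl C (by simp at hC ⊢; tauto))

theorem bigAnd (h : W Formula.bot) {n : ℕ} {A : Fin n → Formula F R}
    (hA : ∀ k, Derives m W T Γ (A k)) : Derives m W T Γ (Formula.bigAnd A) :=
  conj h (by simpa [List.mem_ofFn] using hA)

theorem all_self {x : ℕ} {A : Formula F R} (hx : T x (.var x))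
    (d : Derives m W T Γ (Formula.all x A)) : Derives m W T Γ A := by
  simpa using Derives.allE hx (freeFor_self A x) d

theorem ex_self {x : ℕ} {A : Formula F R} (hW : W (Formula.ex x A)) (hx : T x (.var x))
    (d : Derives m W T Γ A) : Derives m W T Γ (Formula.ex x A) :=
  .exI hW hx (freeFor_self A x) (by simpa using d)

end Derives

/-! ### Sort-respecting instances with renaming of bound variables -/

namespace Signature

variable (L : Signature.{u, v, w})

/-- `L.Inst ρ A B`: the formula `B` arises from `A` by simultaneously substituting `ρ x` for each
free variable `x`, bound variables being renamed, within their sorts, so that none is captured. -/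
inductive Inst : (ℕ → Term L.Fun) → Formula L.Fun L.Rel → Formula L.Fun L.Rel → Prop
  | bot {ρ} : Inst ρ bot bot
  | eq {ρ} (s t) : Inst ρ (eq s t) (eq (s.bind ρ) (t.bind ρ))
  | rel {ρ n} (r : L.Rel n) (ts) : Inst ρ (rel r ts) (rel r fun k => (ts k).bind ρ)
  | and {ρ A A' B B'} (hA : Inst ρ A A') (hB : Inst ρ B B') : Inst ρ (and A B) (and A' B')
  | or {ρ A A' B B'} (hA : Inst ρ A A') (hB : Inst ρ B B') : Inst ρ (or A B) (or A' B')
  | imp {ρ A A' B B'} (hA : Inst ρ A A') (hB : Inst ρ B B') : Inst ρ (imp A B) (imp A' B')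
  | all {ρ x z A B} (hs : L.varSort z = L.varSort x) (hz : ∀ y ∈ (all x A).fv, z ∉ (ρ y).vars)
      (h : Inst (update ρ x (.var z)) A B) : Inst ρ (all x A) (all z B)
  | ex {ρ x z A B} (hs : L.varSort z = L.varSort x) (hz : ∀ y ∈ (ex x A).fv, z ∉ (ρ y).vars)
      (h : Inst (update ρ x (.var z)) A B) : Inst ρ (ex x A) (ex z B)

/-- The assignment `ρ` maps the variables of each sort to terms of that sort. -/
def Respects (ρ : ℕ → Term L.Fun) : Prop := ∀ x i, L.varSort x = some i → L.HasSort (ρ x) i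

/-- `L.Proves m Γ A`: derivability by well-sorted derivations, without equality axioms. -/
abbrev Proves (m : Mode) (Γ : Set (Formula L.Fun L.Rel)) (A : Formula L.Fun L.Rel) : Prop :=
  Derives m L.WellSorted (fun x t => ∃ i, L.varSort x = some i ∧ L.HasSort t i) Γ A

variable {L}

theorem HasSort.unique {t : Term L.Fun} {i j : L.Srt} (hi : L.HasSort t i) (hj : L.HasSort t j) :
    i = j := by
  induction hi generalizing j with
  | var h =>
    cases hj with
    | var h' => exact Option.some.inj (h.symm.trans h')
  | app hts h ih =>
    cases hj with
    | app hts' h' =>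
      obtain rfl := funext fun k => ih k (hts' k)
      exact Option.some.inj (h.symm.trans h')

theorem HasSort.bind {ρ : ℕ → Term L.Fun} (hρ : L.Respects ρ) {t : Term L.Fun} {i : L.Srt}
    (h : L.HasSort t i) : L.HasSort (t.bind ρ) i := by
  induction h with
  | var h => exact hρ _ _ h
  | app hts h ih => exact .app ih h

theorem HasSort.varSort_of_mem {t : Term L.Fun} {i : L.Srt} (h : L.HasSort t i) {x : ℕ}
    (hx : x ∈ t.vars) : ∃ j, L.varSort x = some j := by
  induction h with
  | var h => simp only [Term.vars, Finset.mem_singleton] at hx; exact ⟨_, hx ▸ h⟩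
  | app hts h ih =>
    simp only [Term.vars, Finset.mem_biUnion] at hx
    obtain ⟨k, -, hk⟩ := hx
    exact ih k hk

theorem respects_var : L.Respects .var := fun _ _ h => .var h

theorem Respects.update {ρ : ℕ → Term L.Fun} (hρ : L.Respects ρ) {x : ℕ} {t : Term L.Fun}
    {i : L.Srt} (hx : L.varSort x = some i) (ht : L.HasSort t i) : L.Respects (update ρ x t) := by
  intro y j hy
  by_cases e : y = x
  · subst e
    rw [update_self]
    rwa [← Option.some.inj (hx.symm.trans hy)]
  · rw [update_of_ne e]
    exact hρ y j hy

theorem WellSorted.varSort_of_mem {A : Formula L.Fun L.Rel} (h : L.WellSorted A) {x : ℕ}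
    (hx : x ∈ A.fv) : ∃ j, L.varSort x = some j := by
  induction A with
  | bot => simp [fv] at hx
  | eq s t =>
    obtain ⟨i, hs, ht⟩ := h
    simp only [fv, Finset.mem_union] at hx
    exact hx.elim hs.varSort_of_mem ht.varSort_of_mem
  | rel r ts =>
    obtain ⟨a, -, ha⟩ := h
    simp only [fv, Finset.mem_biUnion] at hx
    obtain ⟨k, -, hk⟩ := hx
    exact (ha k).varSort_of_mem hk
  | and A B ihA ihB | or A B ihA ihB | imp A B ihA ihB =>
    simp only [fv, Finset.mem_union] at hx
    exact hx.elim (ihA h.1) (ihB h.2)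
  | all y A ih | ex y A ih =>
    simp only [fv, Finset.mem_erase] at hx
    exact ih h.2 hx.2

theorem wellSorted_foldr_all {A : Formula L.Fun L.Rel} (hA : L.WellSorted A) {l : List ℕ}
    (hl : ∀ x ∈ l, ∃ i, L.varSort x = some i) : L.WellSorted (l.foldr .all A) := by
  induction l with
  | nil => exact hA
  | cons x l ih => exact ⟨hl x (by simp), ih fun y hy => hl y (by simp [hy])⟩

theorem exists_fresh (i : L.Srt) (V : Finset ℕ) : ∃ z, L.varSort z = some i ∧ z ∉ V :=
  (L.var_infinite i).exists_notMem_finset V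

namespace Inst

variable {ρ : ℕ → Term L.Fun} {A B : Formula L.Fun L.Rel}

theorem congr {σ : ℕ → Term L.Fun} (h : L.Inst ρ A B) (e : ∀ x ∈ A.fv, ρ x = σ x) :
    L.Inst σ A B := by
  induction h generalizing σ with
  | bot => exact .bot
  | eq s t =>
    rw [Term.bind_congr fun x hx => e x (by simp [fv, hx]),
      Term.bind_congr (s := t) fun x hx => e x (by simp [fv, hx])]
    exact .eq s t
  | rel r ts =>
    have : (fun k => (ts k).bind _) = fun k => (ts k).bind σ := funext fun k =>
      Term.bind_congr fun x hx => e x (by simp only [fv, Finset.mem_biUnion]; exact ⟨k, by simp, hx⟩)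
    rw [this]
    exact .rel r ts
  | and _ _ ihA ihB =>
    exact .and (ihA fun x hx => e x (by simp [fv, hx])) (ihB fun x hx => e x (by simp [fv, hx]))
  | or _ _ ihA ihB =>
    exact .or (ihA fun x hx => e x (by simp [fv, hx])) (ihB fun x hx => e x (by simp [fv, hx]))
  | imp _ _ ihA ihB =>
    exact .imp (ihA fun x hx => e x (by simp [fv, hx])) (ihB fun x hx => e x (by simp [fv, hx]))
  | @all ρ x z A B hs hz h ih =>
    refine .all hs (fun y hy => e y hy ▸ hz y hy) (ih fun y hy => ?_)
    by_cases hyx : y = x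
    · subst hyx; simp
    · simpa [hyx] using e y (by simp [fv, hy, hyx])
  | @ex ρ x z A B hs hz h ih =>
    refine .ex hs (fun y hy => e y hy ▸ hz y hy) (ih fun y hy => ?_)
    by_cases hyx : y = x
    · subst hyx; simp
    · simpa [hyx] using e y (by simp [fv, hy, hyx])

theorem refl (A : Formula L.Fun L.Rel) : L.Inst .var A A := by
  induction A with
  | bot => exact .bot
  | eq s t => simpa using Inst.eq (ρ := .var) s t
  | rel r ts => simpa using Inst.rel (ρ := .var) r ts
  | and A B ihA ihB => exact .and ihA ihB
  | or A B ihA ihB => exact .or ihA ihB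
  | imp A B ihA ihB => exact .imp ihA ihB
  | all y A ih =>
    refine .all rfl (fun x hx => ?_) (by simpa using ih)
    simp only [fv, Finset.mem_erase] at hx
    simpa [Term.vars] using Ne.symm hx.1
  | ex y A ih =>
    refine .ex rfl (fun x hx => ?_) (by simpa using ih)
    simp only [fv, Finset.mem_erase] at hx
    simpa [Term.vars] using Ne.symm hx.1

theorem exists_of_mem_fv (h : L.Inst ρ A B) {x : ℕ} (hx : x ∈ B.fv) :
    ∃ y ∈ A.fv, x ∈ (ρ y).vars := by
  induction h with
  | bot => simp [fv] at hx
  | eq s t =>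
    simp only [fv, Finset.mem_union, Term.mem_vars_bind] at hx ⊢
    obtain ⟨y, h⟩ | ⟨y, h⟩ := hx
    exacts [⟨y, .inl h.1, h.2⟩, ⟨y, .inr h.1, h.2⟩]
  | rel r ts =>
    simp only [fv, Finset.mem_biUnion, Finset.mem_univ, true_and, Term.mem_vars_bind] at hx ⊢
    obtain ⟨k, y, h⟩ := hx
    exact ⟨y, ⟨k, h.1⟩, h.2⟩
  | and _ _ ihA ihB | or _ _ ihA ihB | imp _ _ ihA ihB =>
    simp only [fv, Finset.mem_union] at hx ⊢
    obtain hx | hx := hx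
    · obtain ⟨y, h⟩ := ihA hx
      exact ⟨y, .inl h.1, h.2⟩
    · obtain ⟨y, h⟩ := ihB hx
      exact ⟨y, .inr h.1, h.2⟩
  | @all ρ y z A B hs hz h ih | @ex ρ y z A B hs hz h ih =>
    simp only [fv, Finset.mem_erase] at hx ⊢
    obtain ⟨y', hy', h⟩ := ih hx.2
    by_cases e : y' = y
    · subst e
      simp only [update_self, Term.vars, Finset.mem_singleton] at h
      exact absurd h hx.1
    · rw [update_of_ne e] at h
      exact ⟨y', ⟨e, hy'⟩, h⟩

theorem fv_notMem (h : L.Inst ρ A B) {x : ℕ} (hx : ∀ y ∈ A.fv, x ∉ (ρ y).vars) : x ∉ B.fv :=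
  fun hB => let ⟨y, hy, hxy⟩ := h.exists_of_mem_fv hB; hx y hy hxy

theorem mem_fv (h : L.Inst ρ A B) {x y : ℕ} (hy : y ∈ A.fv) (hx : x ∈ (ρ y).vars) : x ∈ B.fv := by
  induction h with
  | bot => simp [fv] at hy
  | eq s t =>
    simp only [fv, Finset.mem_union, Term.mem_vars_bind] at hy ⊢
    exact hy.imp (fun h => ⟨y, h, hx⟩) (fun h => ⟨y, h, hx⟩)
  | rel r ts =>
    simp only [fv, Finset.mem_biUnion, Finset.mem_univ, true_and, Term.mem_vars_bind] at hy ⊢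
    obtain ⟨k, h⟩ := hy
    exact ⟨k, y, h, hx⟩
  | and _ _ ihA ihB | or _ _ ihA ihB | imp _ _ ihA ihB =>
    simp only [fv, Finset.mem_union] at hy ⊢
    exact hy.imp (fun h => ihA h hx) (fun h => ihB h hx)
  | @all ρ y' z A B hs hz h ih | @ex ρ y' z A B hs hz h ih =>
    have hne : x ≠ z := fun e => hz y hy (e ▸ hx)
    simp only [fv, Finset.mem_erase] at hy ⊢
    exact ⟨hne, ih hy.2 (by rwa [update_of_ne hy.1])⟩

/-- Each sort has infinitely many variables, so every bound variable can be renamed within its sort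
to one outside `V`; terms over `V` are then never captured. -/
theorem exists_freeFor (hA : L.WellSorted A) (ρ : ℕ → Term L.Fun) (V : Finset ℕ) :
    ∃ B, L.Inst ρ A B ∧ ∀ z t, t.vars ⊆ V → B.FreeFor z t := by
  induction A generalizing ρ with
  | bot => exact ⟨_, .bot, fun _ _ _ => trivial⟩
  | eq s t => exact ⟨_, .eq s t, fun _ _ _ => trivial⟩
  | rel r ts => exact ⟨_, .rel r ts, fun _ _ _ => trivial⟩
  | and A B ihA ihB =>
    obtain ⟨A', hA', fA⟩ := ihA hA.1 ρ
    obtain ⟨B', hB', fB⟩ := ihB hA.2 ρ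
    exact ⟨_, .and hA' hB', fun z t h => ⟨fA z t h, fB z t h⟩⟩
  | or A B ihA ihB =>
    obtain ⟨A', hA', fA⟩ := ihA hA.1 ρ
    obtain ⟨B', hB', fB⟩ := ihB hA.2 ρ
    exact ⟨_, .or hA' hB', fun z t h => ⟨fA z t h, fB z t h⟩⟩
  | imp A B ihA ihB =>
    obtain ⟨A', hA', fA⟩ := ihA hA.1 ρ
    obtain ⟨B', hB', fB⟩ := ihB hA.2 ρ
    exact ⟨_, .imp hA' hB', fun z t h => ⟨fA z t h, fB z t h⟩⟩
  | all x A ih =>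
    obtain ⟨⟨i, hi⟩, hA⟩ := hA
    obtain ⟨w, hw, hwV⟩ := L.exists_fresh i (V ∪ (Formula.all x A).fv.biUnion fun y => (ρ y).vars)
    obtain ⟨B, hB, f⟩ := ih hA (update ρ x (.var w))
    simp only [Finset.mem_union, Finset.mem_biUnion, not_or, not_exists, not_and] at hwV
    exact ⟨_, .all (hw.trans hi.symm) hwV.2 hB, fun z t h _ => ⟨fun h' => hwV.1 (h h'), f z t h⟩⟩
  | ex x A ih =>
    obtain ⟨⟨i, hi⟩, hA⟩ := hA
    obtain ⟨w, hw, hwV⟩ := L.exists_fresh i (V ∪ (Formula.ex x A).fv.biUnion fun y => (ρ y).vars)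
    obtain ⟨B, hB, f⟩ := ih hA (update ρ x (.var w))
    simp only [Finset.mem_union, Finset.mem_biUnion, not_or, not_exists, not_and] at hwV
    exact ⟨_, .ex (hw.trans hi.symm) hwV.2 hB, fun z t h _ => ⟨fun h' => hwV.1 (h h'), f z t h⟩⟩

theorem subst_of_notMem (h : L.Inst ρ A B) {z : ℕ} {t : Term L.Fun} (hz : z ∉ B.fv) :
    L.Inst (fun y => (ρ y).subst z t) A (B.subst z t) := by
  rw [Formula.subst_of_notMem hz]
  exact h.congr fun y hy => (Term.subst_of_notMem fun hzy => hz (h.mem_fv hy hzy)).symm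

theorem update_subst_var {x z w : ℕ} {t : Term L.Fun} (hw : w ≠ z) :
    (fun y => (update ρ x (.var w) y).subst z t) =
      update (fun y => (ρ y).subst z t) x (.var w) := by
  funext y
  by_cases e : y = x
  · subst e; simp [Term.subst, hw]
  · simp [e]

theorem subst (h : L.Inst ρ A B) {z : ℕ} {t : Term L.Fun} (hf : B.FreeFor z t) :
    L.Inst (fun y => (ρ y).subst z t) A (B.subst z t) := by
  induction h with
  | bot => exact .bot
  | eq s s' =>
    simp only [Formula.subst, Term.bind_subst]
    exact .eq s s'
  | rel r ts =>
    simp only [Formula.subst, Term.bind_subst]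
    exact .rel r ts
  | and _ _ ihA ihB => exact .and (ihA hf.1) (ihB hf.2)
  | or _ _ ihA ihB => exact .or (ihA hf.1) (ihB hf.2)
  | imp _ _ ihA ihB => exact .imp (ihA hf.1) (ihB hf.2)
  | @all ρ x w A B hs hz h ih =>
    by_cases hfv : z ∈ (Formula.all w B).fv
    · obtain ⟨hw, hB⟩ := hf hfv
      have hne : w ≠ z := by rintro rfl; simp [fv] at hfv
      simp only [Formula.subst, hne, if_false]
      refine .all hs (fun y hy hwy => (Term.mem_vars_subst hwy).elim (hz y hy) hw) ?_
      rw [← update_subst_var hne]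
      exact ih hB
    · exact (Inst.all hs hz h).subst_of_notMem hfv
  | @ex ρ x w A B hs hz h ih =>
    by_cases hfv : z ∈ (Formula.ex w B).fv
    · obtain ⟨hw, hB⟩ := hf hfv
      have hne : w ≠ z := by rintro rfl; simp [fv] at hfv
      simp only [Formula.subst, hne, if_false]
      refine .ex hs (fun y hy hwy => (Term.mem_vars_subst hwy).elim (hz y hy) hw) ?_
      rw [← update_subst_var hne]
      exact ih hB
    · exact (Inst.ex hs hz h).subst_of_notMem hfv

/-- When `z` is fresh, it marks exactly the places of `x`, so replacing `z` by `t` has the effect of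
sending `x` to `t` from the start. -/
theorem subst_update {x z : ℕ} (h : L.Inst (update ρ x (.var z)) A B)
    (hz : ∀ y ∈ A.fv.erase x, z ∉ (ρ y).vars) {t : Term L.Fun} (hf : B.FreeFor z t) :
    L.Inst (update ρ x t) A (B.subst z t) := by
  refine (h.subst hf).congr fun y hy => ?_
  by_cases e : y = x
  · subst e; simp [Term.subst]
  · simpa [e] using Term.subst_of_notMem (hz y (by simp [e, hy]))

theorem wellSorted (h : L.Inst ρ A B) (hρ : L.Respects ρ) (hA : L.WellSorted A) :
    L.WellSorted B := by
  induction h with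
  | bot => trivial
  | eq s t =>
    obtain ⟨i, hs, ht⟩ := hA
    exact ⟨i, hs.bind hρ, ht.bind hρ⟩
  | rel r ts =>
    obtain ⟨a, ha, h⟩ := hA
    exact ⟨a, ha, fun k => (h k).bind hρ⟩
  | and _ _ ihA ihB | or _ _ ihA ihB | imp _ _ ihA ihB => exact ⟨ihA hρ hA.1, ihB hρ hA.2⟩
  | @all ρ x z A B hs hz h ih | @ex ρ x z A B hs hz h ih =>
    obtain ⟨⟨i, hi⟩, hA⟩ := hA
    exact ⟨⟨i, hs.trans hi⟩, ih (hρ.update hi (.var (hs.trans hi))) hA⟩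

variable {m : Mode} {Γ : Set (Formula L.Fun L.Rel)} {B' : Formula L.Fun L.Rel}

/-- Instances are unique up to derivable equivalence. -/
theorem proves (h : L.Inst ρ A B) (h' : L.Inst ρ A B') (hρ : L.Respects ρ) (hA : L.WellSorted A)
    (d : L.Proves m Γ B) : L.Proves m Γ B' := by
  induction A generalizing ρ Γ B B' with
  | bot => cases h; cases h'; exact d
  | eq s t => cases h; cases h'; exact d
  | rel r ts => cases h; cases h'; exact d
  | and A₁ A₂ ih₁ ih₂ =>
    cases h with | and h₁ h₂ => cases h' with | and h₁' h₂' =>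
    exact .andI (ih₁ h₁ h₁' hρ hA.1 d.andE₁) (ih₂ h₂ h₂' hρ hA.2 d.andE₂)
  | or A₁ A₂ ih₁ ih₂ =>
    cases h with | or h₁ h₂ => cases h' with | or h₁' h₂' =>
    exact .orE d
      (.orI₁ (h₂'.wellSorted hρ hA.2)
        (ih₁ h₁ h₁' hρ hA.1 (.assumption (by simp) (h₁.wellSorted hρ hA.1))))
      (.orI₂ (h₁'.wellSorted hρ hA.1)
        (ih₂ h₂ h₂' hρ hA.2 (.assumption (by simp) (h₂.wellSorted hρ hA.2))))
  | imp A₁ A₂ ih₁ ih₂ =>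
    cases h with | imp h₁ h₂ => cases h' with | imp h₁' h₂' =>
    have w := h₁'.wellSorted hρ hA.1
    exact .impI w (ih₂ h₂ h₂' hρ hA.2
      (.impE (.weaken (by simp) d) (ih₁ h₁' h₁ hρ hA.1 (.assumption (by simp) w))))
  | all x A ih =>
    have w := h.wellSorted hρ hA
    have w' := h'.wellSorted hρ hA
    have hf := @h.fv_notMem
    obtain ⟨⟨i, hi⟩, hA⟩ := hA
    cases h with | @all _ _ z _ B hs hz h => cases h' with | @all _ _ z' _ B' hs' hz' h' =>
    have hzi := hs.trans hi
    have hzi' := hs'.trans hi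
    -- The cut replaces `Γ` by the single premise, so the eigenvariable condition does not involve
    -- `Γ`.
    refine .cut w ?_ d
    refine .allI w' (by simpa using hf hz') ?_
    -- `z'` may be captured in `B`. The detour through a variant `C` of `B` whose bound variables
    -- avoid `z'` makes the instantiation of `z` by `z'` legal.
    obtain ⟨C, hC, hCf⟩ := exists_freeFor hA (Function.update ρ x (.var z)) {z'}
    have hC' := hC.subst_update hz (hCf z (.var z') (by simp [Term.vars]))
    refine ih hC' h' (hρ.update hi (.var hzi')) hA
      (.allE ⟨i, hzi, .var hzi'⟩ (hCf z (.var z') (by simp [Term.vars])) ?_)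
    refine .allI ⟨⟨i, hzi⟩, hC.wellSorted (hρ.update hi (.var hzi)) hA⟩ (by simp [fv]) ?_
    exact ih h hC (hρ.update hi (.var hzi)) hA
      (.all_self ⟨i, hzi, .var hzi⟩ (.assumption (by simp) w))
  | ex x A ih =>
    have w := h.wellSorted hρ hA
    have w' := h'.wellSorted hρ hA
    have hf' := @h'.fv_notMem
    obtain ⟨⟨i, hi⟩, hA⟩ := hA
    cases h with | @ex _ _ z _ B hs hz h => cases h' with | @ex _ _ z' _ B' hs' hz' h' =>
    have hzi := hs.trans hi
    have hzi' := hs'.trans hi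
    refine .cut w ?_ d
    refine .exE (by simp [fv]) (hf' hz) (.assumption (by simp) w) ?_
    -- Dually, `C` is a variant of `B'` in which `z` is free for `z'`, so that `B` yields `∃ z' C`
    -- with witness `z`.
    obtain ⟨C, hC, hCf⟩ := exists_freeFor hA (Function.update ρ x (.var z')) {z}
    have hC' := hC.subst_update hz' (hCf z' (.var z) (by simp [Term.vars]))
    have wC : L.WellSorted (.ex z' C) :=
      ⟨⟨i, hzi'⟩, hC.wellSorted (hρ.update hi (.var hzi')) hA⟩
    have d₁ : L.Proves m {B} (.ex z' C) :=
      .exI wC ⟨i, hzi', .var hzi⟩ (hCf z' (.var z) (by simp [Term.vars]))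
        (ih h hC' (hρ.update hi (.var hzi)) hA (.assumption (by simp) w.2))
    have d₂ : L.Proves m {.ex z' C} (.ex z' B') :=
      .exE (by simp [fv]) (by simp [fv]) (.assumption (by simp) wC)
        (.ex_self w' ⟨i, hzi', .var hzi'⟩
          (ih hC h' (hρ.update hi (.var hzi')) hA (.assumption (by simp) wC.2)))
    exact .cut wC d₂ (.weaken (by simp) d₁)

/-- Pass to a variant of `B` with a fresh quantified variable and no capture of `t`, eliminate
there, and pass to `B'` by `Inst.proves`. -/
theorem proves_all_elim {x : ℕ} {i : L.Srt} {t : Term L.Fun} (h : L.Inst ρ (.all x A) B)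
    (h' : L.Inst (update ρ x t) A B') (hρ : L.Respects ρ) (hA : L.WellSorted A)
    (hx : L.varSort x = some i) (ht : L.HasSort t i) (d : L.Proves m Γ B) : L.Proves m Γ B' := by
  obtain ⟨z, hz, hzf⟩ := L.exists_fresh i ((Formula.all x A).fv.biUnion fun y => (ρ y).vars)
  simp only [Finset.mem_biUnion, not_exists, not_and] at hzf
  obtain ⟨C, hC, hCf⟩ := exists_freeFor hA (Function.update ρ x (.var z)) t.vars
  have hf := hCf z t subset_rfl
  exact (hC.subst_update hzf hf).proves h' (hρ.update hx ht) hA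
    (.allE ⟨i, hz, ht⟩ hf (h.proves (.all (hz.trans hx.symm) hzf hC) hρ ⟨⟨i, hx⟩, hA⟩ d))

theorem proves_ex_intro {x : ℕ} {i : L.Srt} {t : Term L.Fun} (h : L.Inst ρ (.ex x A) B)
    (h' : L.Inst (update ρ x t) A B') (hρ : L.Respects ρ) (hA : L.WellSorted A)
    (hx : L.varSort x = some i) (ht : L.HasSort t i) (d : L.Proves m Γ B') : L.Proves m Γ B := by
  obtain ⟨z, hz, hzf⟩ := L.exists_fresh i ((Formula.ex x A).fv.biUnion fun y => (ρ y).vars)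
  simp only [Finset.mem_biUnion, not_exists, not_and] at hzf
  obtain ⟨C, hC, hCf⟩ := exists_freeFor hA (Function.update ρ x (.var z)) t.vars
  have hf := hCf z t subset_rfl
  have hex : L.Inst ρ (.ex x A) (.ex z C) := .ex (hz.trans hx.symm) hzf hC
  exact hex.proves h hρ ⟨⟨i, hx⟩, hA⟩ (.exI (hex.wellSorted hρ ⟨⟨i, hx⟩, hA⟩) ⟨i, hz, ht⟩ hf
    (h'.proves (hC.subst_update hzf hf) (hρ.update hx ht) hA d))

/-- Eliminating the quantifiers from the outside changes the values of `ρ` into those of `σ` one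
variable at a time, so agreement is needed only at free variables outside the block. -/
theorem proves_foldr_all {l : List ℕ} {σ : ℕ → Term L.Fun} (hl : ∀ x ∈ l, ∃ i, L.varSort x = some i)
    (h : L.Inst ρ (l.foldr .all A) B) (h' : L.Inst σ A B') (hρ : L.Respects ρ) (hσ : L.Respects σ)
    (e : ∀ y ∈ A.fv, y ∉ l → ρ y = σ y) (hA : L.WellSorted A) (d : L.Proves m Γ B) :
    L.Proves m Γ B' := by
  induction l generalizing ρ B with
  | nil => exact (h.congr (by simpa using e)).proves h' hσ hA d
  | cons x l ih =>
    obtain ⟨i, hi⟩ := hl x (by simp)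
    have hl' : ∀ x ∈ l, ∃ i, L.varSort x = some i := fun y hy => hl y (by simp [hy])
    have hW := wellSorted_foldr_all hA hl'
    obtain ⟨C, hC, -⟩ := exists_freeFor hW (Function.update ρ x (σ x)) ∅
    have hρ' := hρ.update hi (hσ x i hi)
    refine ih hl' hC hρ' (fun y hy hyl => ?_) (h.proves_all_elim hC hρ hW hi (hσ x i hi) d)
    by_cases hyx : y = x
    · subst hyx; simp
    · simpa [hyx] using e y hy (by simp [hyx, hyl])

theorem conj {ι : Type*} {A B : ι → Formula L.Fun L.Rel} (h : ∀ k, L.Inst ρ (A k) (B k)) :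
    ∀ l : List ι, L.Inst ρ (conj (l.map A)) (conj (l.map B))
  | [] => .imp .bot .bot
  | [k] => h k
  | k :: k' :: l => .and (h k) (conj h (k' :: l))

theorem bigAnd {n : ℕ} {A B : Fin n → Formula L.Fun L.Rel} (h : ∀ k, L.Inst ρ (A k) (B k)) :
    L.Inst ρ (bigAnd A) (bigAnd B) := by
  rw [bigAnd_eq, bigAnd_eq]
  exact conj h _

end Inst

/-- A derivable universal closure yields all sort-respecting instances. -/
theorem Proves.of_univClosure {m : Mode} {Γ : Set (Formula L.Fun L.Rel)}
    {A B : Formula L.Fun L.Rel} {σ : ℕ → Term L.Fun} (d : L.Proves m Γ A.univClosure)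
    (hA : L.WellSorted A) (hσ : L.Respects σ) (h : L.Inst σ A B) : L.Proves m Γ B := by
  refine (Inst.refl A.univClosure).proves_foldr_all (fun x hx => ?_) h respects_var hσ
    (fun y hy hyl => ?_) hA d
  · exact hA.varSort_of_mem (by simpa using hx)
  · exact absurd hy (by simpa using hyl)

theorem wellSorted_conj {ι : Type*} {A : ι → Formula L.Fun L.Rel} (h : ∀ k, L.WellSorted (A k)) :
    ∀ l : List ι, L.WellSorted (conj (l.map A))
  | [] => ⟨trivial, trivial⟩
  | [k] => h k
  | k :: k' :: l => ⟨h k, wellSorted_conj h (k' :: l)⟩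

theorem wellSorted_bigAnd {n : ℕ} {A : Fin n → Formula L.Fun L.Rel}
    (h : ∀ k, L.WellSorted (A k)) : L.WellSorted (bigAnd A) := by
  rw [bigAnd_eq]
  exact wellSorted_conj h _

/-- Finitely many well-sorted terms are the values of suitable variables under a sort-respecting
assignment. -/
theorem exists_respects {ι : Type*} [Finite ι] {a : ι → L.Srt} {t : ι → Term L.Fun}
    (ht : ∀ k, L.HasSort (t k) (a k)) : ∃ x : ι → ℕ, ∃ σ, (∀ k, L.varSort (x k) = some (a k)) ∧
      L.Respects σ ∧ ∀ k, σ (x k) = t k := by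
  obtain ⟨n, ⟨e⟩⟩ := Finite.exists_equiv_fin ι
  -- Index `k` receives variable number `e k` of its sort. Variables of different sorts differ by
  -- disjointness, those of one sort by their numbers, even if the terms coincide.
  let f (i : L.Srt) := (L.var_infinite i).natEmbedding
  let x (k : ι) : ℕ := f (a k) (e k)
  have hx (k : ι) : L.varSort (x k) = some (a k) := (f (a k) (e k)).2
  have inj : Injective x := by
    intro k k' h
    have ha : a k = a k' := Option.some.inj ((hx k).symm.trans (h ▸ hx k'))
    have hf : ∀ i i' p q, i = i' → (f i p : ℕ) = f i' q → p = q := by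
      rintro i _ p q rfl h
      exact (f i).injective (Subtype.ext h)
    exact e.injective (Fin.ext (hf _ _ _ _ ha h))
  refine ⟨x, extend x t .var, hx, fun y i hy => ?_, fun k => inj.extend_apply _ _ k⟩
  by_cases h : ∃ k, x k = y
  · obtain ⟨k, rfl⟩ := h
    rw [inj.extend_apply, ← Option.some.inj ((hx k).symm.trans hy)]
    exact ht k
  · rw [extend_apply' _ _ _ h]
    exact .var hy

end Signature

/-! ### Equality axioms for arbitrary well-sorted terms -/

namespace Signature

variable {L : Signature.{u, v, w}} {m : Mode}

theorem EqAxiom.wellSorted {A : Formula L.Fun L.Rel} (h : L.EqAxiom A) : L.WellSorted A := by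
  cases h with
  | refl x hx => exact ⟨_, .var hx, .var hx⟩
  | symm x y hx hy => exact ⟨⟨_, .var hx, .var hy⟩, ⟨_, .var hy, .var hx⟩⟩
  | trans x y z hx hy hz =>
    exact ⟨⟨⟨_, .var hx, .var hy⟩, ⟨_, .var hy, .var hz⟩⟩, ⟨_, .var hx, .var hz⟩⟩
  | relCongr r a ha x y hx hy =>
    exact ⟨wellSorted_bigAnd fun k => ⟨_, .var (hx k), .var (hy k)⟩,
      ⟨a, ha, fun k => .var (hx k)⟩, ⟨a, ha, fun k => .var (hy k)⟩⟩
  | funCongr f a i ha x y hx hy =>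
    exact ⟨wellSorted_bigAnd fun k => ⟨_, .var (hx k), .var (hy k)⟩,
      ⟨i, .app (fun k => .var (hx k)) ha, .app (fun k => .var (hy k)) ha⟩⟩

theorem WellSorted.univClosure {A : Formula L.Fun L.Rel} (hA : L.WellSorted A) :
    L.WellSorted A.univClosure :=
  wellSorted_foldr_all hA fun _ hx => hA.varSort_of_mem (by simpa using hx)

section Equality

variable {Γ : Set (Formula L.Fun L.Rel)} (hΓ : univClosure '' {B | L.EqAxiom B} ⊆ Γ)

include hΓ

theorem EqAxiom.proves {A B : Formula L.Fun L.Rel} (h : L.EqAxiom A) {σ : ℕ → Term L.Fun}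
    (hσ : L.Respects σ) (hB : L.Inst σ A B) : L.Proves m Γ B :=
  Proves.of_univClosure (.assumption (hΓ ⟨A, h, rfl⟩) h.wellSorted.univClosure) h.wellSorted hσ hB

theorem proves_eq_refl {t : Term L.Fun} {i : L.Srt} (ht : L.HasSort t i) :
    L.Proves m Γ (.eq t t) := by
  obtain ⟨x, σ, hx, hσ, e⟩ := exists_respects (L := L) (ι := Unit) fun _ => ht
  simpa [Term.bind, e] using (EqAxiom.refl _ (hx ())).proves (m := m) hΓ hσ (.eq _ _)

theorem proves_eq_symm {s t : Term L.Fun} {i : L.Srt} (hs : L.HasSort s i) (ht : L.HasSort t i)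
    (d : L.Proves m Γ (.eq s t)) : L.Proves m Γ (.eq t s) := by
  obtain ⟨x, σ, hx, hσ, e⟩ := exists_respects (L := L) (ι := Fin 2) (a := fun _ => i)
    (t := ![s, t]) (by simp [Fin.forall_fin_two, hs, ht])
  have h := (EqAxiom.symm _ _ (hx 0) (hx 1)).proves (m := m) hΓ hσ (.imp (.eq _ _) (.eq _ _))
  simp only [Term.bind, e] at h
  exact h.impE d

theorem proves_eq_trans {s t r : Term L.Fun} {i : L.Srt} (hs : L.HasSort s i)
    (ht : L.HasSort t i) (hr : L.HasSort r i) (d : L.Proves m Γ (.eq s t))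
    (d' : L.Proves m Γ (.eq t r)) : L.Proves m Γ (.eq s r) := by
  obtain ⟨x, σ, hx, hσ, e⟩ := exists_respects (L := L) (ι := Fin 3) (a := fun _ => i)
    (t := ![s, t, r]) (by simp [Fin.forall_fin_succ, hs, ht, hr])
  have h := (EqAxiom.trans _ _ _ (hx 0) (hx 1) (hx 2)).proves (m := m) hΓ hσ
    (.imp (.and (.eq _ _) (.eq _ _)) (.eq _ _))
  simp only [Term.bind, e] at h
  exact h.impE (d.andI d')

theorem proves_relCongr {n : ℕ} {r : L.Rel n} {a : Fin n → L.Srt} (ha : a ∈ L.relRank r)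
    {s t : Fin n → Term L.Fun} (hs : ∀ k, L.HasSort (s k) (a k)) (ht : ∀ k, L.HasSort (t k) (a k))
    (d : ∀ k, L.Proves m Γ (.eq (s k) (t k))) (d' : L.Proves m Γ (.rel r s)) :
    L.Proves m Γ (.rel r t) := by
  obtain ⟨x, σ, hx, hσ, e⟩ := exists_respects (L := L) (ι := Fin n ⊕ Fin n) (a := Sum.elim a a)
    (t := Sum.elim s t) (by simp [hs, ht])
  have h := (EqAxiom.relCongr r a ha _ _ (fun k => hx (.inl k)) (fun k => hx (.inr k))).proves
    (m := m) hΓ hσ (.imp (.bigAnd fun k => .eq _ _) (.imp (.rel _ _) (.rel _ _)))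
  simp only [Term.bind, e, Sum.elim_inl, Sum.elim_inr] at h
  exact (h.impE (.bigAnd trivial d)).impE d'

theorem proves_funCongr {n : ℕ} {f : L.Fun n} {a : Fin n → L.Srt} {i : L.Srt}
    (ha : L.funRank f a = some i) {s t : Fin n → Term L.Fun} (hs : ∀ k, L.HasSort (s k) (a k))
    (ht : ∀ k, L.HasSort (t k) (a k)) (d : ∀ k, L.Proves m Γ (.eq (s k) (t k))) :
    L.Proves m Γ (.eq (.app f s) (.app f t)) := by
  obtain ⟨x, σ, hx, hσ, e⟩ := exists_respects (L := L) (ι := Fin n ⊕ Fin n) (a := Sum.elim a a)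
    (t := Sum.elim s t) (by simp [hs, ht])
  have h := (EqAxiom.funCongr f a i ha _ _ (fun k => hx (.inl k)) (fun k => hx (.inr k))).proves
    (m := m) hΓ hσ (.imp (.bigAnd fun k => .eq _ _) (.eq _ _))
  simp only [Term.bind, e, Sum.elim_inl, Sum.elim_inr] at h
  exact h.impE (.bigAnd trivial d)

end Equality

/-! ### The forcing model -/

/-- Only finitely many variables occur free in `Γ`. -/
def FinFree (Γ : Set (Formula L.Fun L.Rel)) : Prop := {x | ∃ B ∈ Γ, x ∈ B.fv}.Finite

theorem FinFree.insert {Γ : Set (Formula L.Fun L.Rel)} (h : FinFree Γ) (A : Formula L.Fun L.Rel) :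
    FinFree (insert A Γ) :=
  (h.union A.fv.finite_toSet).subset (by
    rintro x ⟨B, rfl | hB, hx⟩
    exacts [.inr hx, .inl ⟨B, hB, hx⟩])

theorem FinFree.exists_fresh {Γ : Set (Formula L.Fun L.Rel)} (h : FinFree Γ) (i : L.Srt)
    (V : Finset ℕ) : ∃ z, L.varSort z = some i ∧ z ∉ V ∧ ∀ B ∈ Γ, z ∉ B.fv := by
  unfold FinFree at h
  obtain ⟨z, hz, hzV⟩ := L.exists_fresh i (V ∪ h.toFinset)
  rw [Finset.mem_union, not_or, Set.Finite.mem_toFinset] at hzV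
  exact ⟨z, hz, hzV.1, fun B hB hzB => hzV.2 ⟨B, hB, hzB⟩⟩

/-- The closure of a set of assumption sets: `Γ` lies in it if, hereditarily, it derives whatever
is derivable from all larger members of the set. -/
def Closure (m : Mode) (P : Set (Formula L.Fun L.Rel) → Prop) (Γ : Set (Formula L.Fun L.Rel)) :
    Prop :=
  ∀ Δ, Γ ⊆ Δ → FinFree Δ → ∀ E, L.WellSorted E →
    (∀ Θ, Δ ⊆ Θ → FinFree Θ → P Θ → L.Proves m Θ E) → L.Proves m Δ E

/-- A well-sorted formula is accepted when derivable, any other only in case of inconsistency. -/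
def Accepts (m : Mode) (A : Formula L.Fun L.Rel) (Γ : Set (Formula L.Fun L.Rel)) : Prop :=
  (L.WellSorted A → L.Proves m Γ A) ∧ (¬L.WellSorted A → L.Proves m Γ .bot)

/-- `L.Unsorted t`: the term `t` is ill sorted. -/
def Unsorted (L : Signature.{u, v, w}) (t : Term L.Fun) : Prop := ∀ i, ¬L.HasSort t i

/-- Forcing of relational atoms. -/
def ForceRel (m : Mode) (Γ : Set (Formula L.Fun L.Rel)) :
    ∀ {n : ℕ}, StarRel L.Rel L.Srt n → (Fin n → Term L.Fun) → Prop
  | _, .old r, ts => Accepts m (.rel r ts) Γ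
  | _, .Q i, ts => L.HasSort (ts 0) i ∨ L.Proves m Γ .bot

/-- Forcing of unsorted formulas by sets of many-sorted formulas. The domain consists of all terms;
ill-sorted terms are equal to each other and satisfy no atomic predicate. -/
def Force (m : Mode) : L.StarFormula → (ℕ → Term L.Fun) → Set (Formula L.Fun L.Rel) → Prop
  | .bot, _, Γ => L.Proves m Γ .bot
  | .eq s t, ρ, Γ => (L.Unsorted (s.bind ρ) ∧ L.Unsorted (t.bind ρ)) ∨
      Accepts m (.eq (s.bind ρ) (t.bind ρ)) Γ
  | .rel r ts, ρ, Γ => ForceRel m Γ r fun k => (ts k).bind ρ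
  | .and A B, ρ, Γ => Force m A ρ Γ ∧ Force m B ρ Γ
  | .or A B, ρ, Γ => Closure m (fun Δ => Force m A ρ Δ ∨ Force m B ρ Δ) Γ
  | .imp A B, ρ, Γ => ∀ Δ, Γ ⊆ Δ → FinFree Δ → Force m A ρ Δ → Force m B ρ Δ
  | .all x A, ρ, Γ => ∀ t, Force m A (update ρ x t) Γ
  | .ex x A, ρ, Γ => Closure m (fun Δ => ∃ t, Force m A (update ρ x t) Δ) Γ

section Closure

variable {P Q : Set (Formula L.Fun L.Rel) → Prop} {Γ Δ : Set (Formula L.Fun L.Rel)}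

theorem Closure.weaken (h : Closure m P Γ) (hΓ : Γ ⊆ Δ) : Closure m P Δ :=
  fun Θ hΘ => h Θ (hΓ.trans hΘ)

theorem Closure.mono (h : Closure m P Γ) (hPQ : ∀ Δ, Γ ⊆ Δ → FinFree Δ → P Δ → Q Δ) :
    Closure m Q Γ :=
  fun Δ hΔ fΔ E hE d => h Δ hΔ fΔ E hE fun Θ hΘ fΘ p => d Θ hΘ fΘ (hPQ Θ (hΔ.trans hΘ) fΘ p)

theorem Closure.of_self (h : ∀ Δ, Γ ⊆ Δ → P Δ) : Closure m P Γ :=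
  fun Δ hΔ fΔ _ _ d => d Δ subset_rfl fΔ (h Δ hΔ)

theorem Closure.idem (h : Closure m (Closure m P) Γ) : Closure m P Γ :=
  fun Δ hΔ fΔ E hE d => h Δ hΔ fΔ E hE fun Θ hΘ fΘ p =>
    p Θ subset_rfl fΘ E hE fun Ξ hΞ => d Ξ (hΘ.trans hΞ)

theorem Closure.proves {E : Formula L.Fun L.Rel} (h : Closure m (fun Δ => L.Proves m Δ E) Γ)
    (hΓ : FinFree Γ) (hE : L.WellSorted E) : L.Proves m Γ E :=
  h Γ subset_rfl hΓ E hE fun _ _ _ d => d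

end Closure

theorem Accepts.weaken {A : Formula L.Fun L.Rel} {Γ Δ : Set (Formula L.Fun L.Rel)}
    (h : Accepts m A Γ) (hΓ : Γ ⊆ Δ) : Accepts m A Δ :=
  ⟨fun w => .weaken hΓ (h.1 w), fun w => .weaken hΓ (h.2 w)⟩

theorem Accepts.of_closure {A : Formula L.Fun L.Rel} {Γ : Set (Formula L.Fun L.Rel)}
    (h : Closure m (Accepts m A) Γ) (hΓ : FinFree Γ) : Accepts m A Γ :=
  ⟨fun w => (h.mono fun _ _ _ p => p.1 w).proves hΓ w,
    fun w => (h.mono fun _ _ _ p => p.2 w).proves hΓ trivial⟩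

namespace Force

variable {Γ Δ : Set (Formula L.Fun L.Rel)} {ρ σ : ℕ → Term L.Fun}

theorem weaken {A : L.StarFormula} (h : Force m A ρ Γ) (hΓ : Γ ⊆ Δ) : Force m A ρ Δ := by
  induction A generalizing ρ with
  | bot => exact Derives.weaken hΓ h
  | eq s t => exact Or.imp id (fun h => h.weaken hΓ) h
  | rel r ts =>
    cases r with
    | old r => exact Accepts.weaken h hΓ
    | Q i => exact Or.imp id (Derives.weaken hΓ) h
  | and A B ihA ihB => exact ⟨ihA h.1, ihB h.2⟩
  | or A B | ex x A => exact Closure.weaken h hΓ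
  | imp A B => exact fun Θ hΘ => h Θ (hΓ.trans hΘ)
  | all x A ih => exact fun t => ih (h t)

/-- Atoms are stable because they amount to derivability of a well-sorted formula or to a condition
on terms that is the same at all worlds; `∨` and `∃` are stable because `Closure` is idempotent. -/
theorem of_closure {A : L.StarFormula} (h : Closure m (Force m A ρ) Γ) (hΓ : FinFree Γ) :
    Force m A ρ Γ := by
  induction A generalizing ρ Γ with
  | bot => exact Closure.proves h hΓ trivial
  | eq s t =>
    by_cases hu : L.Unsorted (s.bind ρ) ∧ L.Unsorted (t.bind ρ)
    · exact .inl hu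
    · exact .inr (Accepts.of_closure (h.mono fun _ _ _ p => p.resolve_left hu) hΓ)
  | rel r ts =>
    cases r with
    | old r => exact Accepts.of_closure h hΓ
    | Q i =>
      by_cases hs : L.HasSort ((ts 0).bind ρ) i
      · exact .inl hs
      · exact .inr (Closure.proves (h.mono fun _ _ _ p => Or.resolve_left p hs) hΓ trivial)
  | and A B ihA ihB =>
    exact ⟨ihA (h.mono fun _ _ _ p => p.1) hΓ, ihB (h.mono fun _ _ _ p => p.2) hΓ⟩
  | or A B | ex x A => exact Closure.idem h
  | imp A B ihA ihB =>
    exact fun Δ hΔ fΔ hA => ihB ((h.weaken hΔ).mono fun Θ hΘ fΘ p =>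
      p Θ subset_rfl fΘ (hA.weaken hΘ)) fΔ
  | all x A ih => exact fun t => ih (h.mono fun _ _ _ p => p t) hΓ

theorem bind_closure {P : Set (Formula L.Fun L.Rel) → Prop} {A : L.StarFormula}
    (h : Closure m P Γ) (hΓ : FinFree Γ) (hA : ∀ Δ, Γ ⊆ Δ → FinFree Δ → P Δ → Force m A ρ Δ) :
    Force m A ρ Γ :=
  of_closure (h.mono hA) hΓ

/-- An inconsistent world derives every well-sorted formula, hence lies in every closure. -/
theorem of_bot {A : L.StarFormula} (h : L.Proves m Γ .bot) (hΓ : FinFree Γ) : Force m A ρ Γ :=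
  of_closure (fun _ hΔ _ _ hE _ => .botE hE (.weaken hΔ h)) hΓ

theorem congr {A : L.StarFormula} (e : ∀ x ∈ A.fv, ρ x = σ x) :
    Force m A ρ Γ ↔ Force m A σ Γ := by
  induction A generalizing ρ σ Γ with
  | bot => exact Iff.rfl
  | eq s t =>
    simp only [Force]
    rw [Term.bind_congr fun x hx => e x (by simp [fv, hx]),
      Term.bind_congr (s := t) fun x hx => e x (by simp [fv, hx])]
  | rel r ts =>
    have : (fun k => (ts k).bind ρ) = fun k => (ts k).bind σ := funext fun k =>
      Term.bind_congr fun x hx => e x (by simp only [fv, Finset.mem_biUnion]; exact ⟨k, by simp, hx⟩)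
    simp only [Force, this]
  | and A B ihA ihB | or A B ihA ihB | imp A B ihA ihB =>
    have hA : ∀ {Γ}, Force m A ρ Γ ↔ Force m A σ Γ := ihA fun x hx => e x (by simp [fv, hx])
    have hB : ∀ {Γ}, Force m B ρ Γ ↔ Force m B σ Γ := ihB fun x hx => e x (by simp [fv, hx])
    simp only [Force, hA, hB]
  | all y A ih | ex y A ih =>
    have hA : ∀ {Γ} t, Force m A (update ρ y t) Γ ↔ Force m A (update σ y t) Γ := by
      refine fun t => ih fun x hx => ?_
      by_cases h : x = y
      · subst h; simp
      · simpa [h] using e x (by simp [fv, hx, h])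
    simp only [Force, hA]

theorem subst {A : L.StarFormula} {x : ℕ} {t : Term L.Fun} (hf : A.FreeFor x t) :
    Force m (A.subst x t) ρ Γ ↔ Force m A (update ρ x (t.bind ρ)) Γ := by
  induction A generalizing ρ Γ with
  | bot => exact Iff.rfl
  | eq s t => simp only [Formula.subst, Force, Term.subst_bind]
  | rel r ts => simp only [Formula.subst, Force, Term.subst_bind]
  | and A B ihA ihB | or A B ihA ihB | imp A B ihA ihB =>
    simp only [Formula.subst, Force, ihA hf.1, ihB hf.2]
  | all y A ih | ex y A ih =>
    by_cases hx : x ∈ A.fv.erase y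
    · have hne : y ≠ x := by rintro rfl; simp at hx
      obtain ⟨hy, hA⟩ := hf hx
      have (d : Term L.Fun) : t.bind (update ρ y d) = t.bind ρ :=
        Term.bind_congr fun z hz => update_of_ne (by rintro rfl; exact hy hz) _ _
      simp only [Formula.subst, hne, if_false, Force, ih hA, this, update_comm hne]
    · rw [Formula.subst_of_notMem hx]
      exact congr fun z hz => (update_of_ne (by rintro rfl; exact hx hz) _ _).symm

theorem update_iff {A : L.StarFormula} {x : ℕ} (hx : x ∉ A.fv) {t : Term L.Fun} :
    Force m A (update ρ x t) Γ ↔ Force m A ρ Γ :=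
  congr fun _ hz => update_of_ne (by rintro rfl; exact hx hz) _ _

theorem sound {Φ : Set L.StarFormula} {A : L.StarFormula}
    (d : Derives m (fun _ => True) (fun _ _ => True) Φ A) (hΓ : FinFree Γ)
    (h : ∀ B ∈ Φ, Force m B ρ Γ) : Force m A ρ Γ := by
  have hins {Φ : Set L.StarFormula} {Γ Δ : Set (Formula L.Fun L.Rel)} {ρ : ℕ → Term L.Fun}
      (h : ∀ B ∈ Φ, Force m B ρ Γ) (hΔ : Γ ⊆ Δ) {C : L.StarFormula} (hC : Force m C ρ Δ) :
      ∀ B ∈ insert C Φ, Force m B ρ Δ := by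
    rintro B (rfl | hB)
    exacts [hC, (h B hB).weaken hΔ]
  induction d generalizing ρ Γ with
  | assumption hA _ => exact h _ hA
  | weaken hs _ ih => exact ih hΓ fun B hB => h B (hs hB)
  | andI _ _ ih₁ ih₂ => exact ⟨ih₁ hΓ h, ih₂ hΓ h⟩
  | andE₁ _ ih => exact (ih hΓ h).1
  | andE₂ _ ih => exact (ih hΓ h).2
  | orI₁ _ _ ih => exact .of_self fun Δ hΔ => .inl ((ih hΓ h).weaken hΔ)
  | orI₂ _ _ ih => exact .of_self fun Δ hΔ => .inr ((ih hΓ h).weaken hΔ)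
  | orE _ _ _ ih ih₁ ih₂ =>
    refine bind_closure (ih hΓ h) hΓ fun Δ hΔ fΔ p => ?_
    exact p.elim (fun p => ih₁ fΔ (hins h hΔ p)) (fun p => ih₂ fΔ (hins h hΔ p))
  | impI _ _ ih => exact fun Δ hΔ fΔ p => ih fΔ (hins h hΔ p)
  | impE _ _ ih₁ ih₂ => exact ih₁ hΓ h Γ subset_rfl hΓ (ih₂ hΓ h)
  | botE _ _ ih => exact of_bot (ih hΓ h) hΓ
  | raa hm _ _ ih =>
    refine of_closure (fun Δ hΔ fΔ E hE d => ?_) hΓ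
    -- Reductio is applied to the well-sorted test formula `E`, not to `A`: once `¬E` is assumed,
    -- any world forcing `A` derives `E` and is inconsistent, so `¬A` is forced.
    refine .raa hm hE (ih (fΔ.insert _) (hins h (hΔ.trans (Set.subset_insert _ _)) ?_))
    exact fun Θ hΘ fΘ p => .impE (.assumption (hΘ (.inl rfl)) ⟨hE, trivial⟩)
      (d Θ ((Set.subset_insert _ _).trans hΘ) fΘ p)
  | allI _ hx _ ih => exact fun t => ih hΓ fun B hB => (update_iff (hx B hB)).2 (h B hB)
  | allE _ hf _ ih => exact (Force.subst hf).2 (ih hΓ h _)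
  | exI _ _ hf _ ih =>
    exact .of_self fun Δ hΔ => ⟨_, ((Force.subst hf).1 (ih hΓ h)).weaken hΔ⟩
  | exE hx hC _ _ ih ih₁ =>
    refine bind_closure (ih hΓ h) hΓ fun Δ hΔ fΔ ⟨t, p⟩ => (update_iff (t := t) hC).1 (ih₁ fΔ ?_)
    exact hins (fun B hB => (update_iff (hx B hB)).2 (h B hB)) hΔ p

theorem univClosure {A : L.StarFormula} (h : ∀ ρ, Force m A ρ Γ) : Force m A.univClosure ρ Γ := by
  rw [Formula.univClosure]
  induction A.fv.sort (· ≤ ·) generalizing ρ with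
  | nil => exact h ρ
  | cons x l ih => exact fun t => ih

theorem conj {ι : Type*} {A : ι → L.StarFormula} : ∀ {l : List ι},
    Force m (Formula.conj (l.map A)) ρ Γ → ∀ k ∈ l, Force m (A k) ρ Γ
  | [], _, k, hk => by simp at hk
  | [k'], h, k, hk => by
    obtain rfl : k = k' := by simpa using hk
    exact h
  | k' :: k'' :: l, h, k, hk => by
    obtain rfl | hk := List.mem_cons.1 hk
    exacts [h.1, conj (l := k'' :: l) h.2 k hk]

theorem bigAnd {n : ℕ} {A : Fin n → L.StarFormula} (h : Force m (Formula.bigAnd A) ρ Γ)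
    (k : Fin n) : Force m (A k) ρ Γ := by
  rw [bigAnd_eq] at h
  exact conj h k (by simp)

theorem eq_cases {s t : Term L.Fun} (h : Force m (.eq s t) ρ Γ) :
    L.Proves m Γ .bot ∨ (L.Unsorted (s.bind ρ) ∧ L.Unsorted (t.bind ρ)) ∨
      ∃ i, L.HasSort (s.bind ρ) i ∧ L.HasSort (t.bind ρ) i ∧
        L.Proves m Γ (.eq (s.bind ρ) (t.bind ρ)) := by
  by_cases w : L.WellSorted (.eq (s.bind ρ) (t.bind ρ))
  · obtain ⟨i, hs, ht⟩ := id w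
    exact h.elim (fun h => .inr (.inl h)) fun h => .inr (.inr ⟨i, hs, ht, h.1 w⟩)
  · exact h.elim (fun h => .inr (.inl h)) fun h => .inl (h.2 w)

theorem eq_of_proves {s t : Term L.Fun} {i : L.Srt} (hs : L.HasSort (s.bind ρ) i)
    (ht : L.HasSort (t.bind ρ) i) (d : L.Proves m Γ (.eq (s.bind ρ) (t.bind ρ))) :
    Force m (.eq s t) ρ Γ :=
  .inr ⟨fun _ => d, fun w => (w ⟨i, hs, ht⟩).elim⟩

theorem not_unsorted {t : Term L.Fun} (h : ¬L.Unsorted t) : ∃ i, L.HasSort t i := by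
  simpa [Unsorted] using h

/-- At a consistent world, equal terms are either both ill-sorted or of one common sort with a
derivable equation. Equality therefore preserves sorts, and congruence reduces to the many-sorted
axioms or to atoms on ill-sorted arguments. -/
theorem eqAxiom (hE : Formula.univClosure '' {B | L.EqAxiom B} ⊆ Γ)
    {A : L.StarFormula} (h : FOLEqAxiom A) : Force m A ρ Γ := by
  have mono {Δ} (hΔ : Γ ⊆ Δ) := hE.trans hΔ
  have eqs {n : ℕ} {x y : Fin n → ℕ} {Δ : Set (Formula L.Fun L.Rel)}
      (h : Force m (Formula.bigAnd fun k => .eq (.var (x k)) (.var (y k))) ρ Δ) :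
      L.Proves m Δ .bot ∨ (∀ k i, L.HasSort (ρ (x k)) i ↔ L.HasSort (ρ (y k)) i) ∧
        ∀ k i, L.HasSort (ρ (x k)) i → L.Proves m Δ (.eq (ρ (x k)) (ρ (y k))) := by
    by_cases hb : L.Proves m Δ .bot
    · exact .inl hb
    · refine .inr (forall_and.1 fun k => ?_)
      obtain ⟨hx, hy⟩ | ⟨i, hx, hy, d⟩ := (h.bigAnd k).eq_cases.resolve_left hb
      · exact ⟨fun i => iff_of_false (hx i) (hy i), fun i h => (hx i h).elim⟩
      · exact ⟨fun j => ⟨fun h => h.unique hx ▸ hy, fun h => h.unique hy ▸ hx⟩, fun _ _ => d⟩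
  cases h with
  | refl x =>
    by_cases hu : L.Unsorted (ρ x)
    · exact .inl ⟨hu, hu⟩
    · obtain ⟨i, hi⟩ := not_unsorted hu
      exact eq_of_proves hi hi (proves_eq_refl hE hi)
  | symm x y =>
    intro Δ hΔ fΔ h
    obtain h | ⟨hx, hy⟩ | ⟨i, hx, hy, d⟩ := h.eq_cases
    · exact of_bot h fΔ
    · exact .inl ⟨hy, hx⟩
    · exact eq_of_proves hy hx (proves_eq_symm (mono hΔ) hx hy d)
  | trans x y z =>
    rintro Δ hΔ fΔ ⟨h, h'⟩
    obtain h | ⟨hx, hy⟩ | ⟨i, hx, hy, d⟩ := h.eq_cases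
    · exact of_bot h fΔ
    · obtain h | ⟨hy', hz⟩ | ⟨j, hy', hz, d'⟩ := h'.eq_cases
      · exact of_bot h fΔ
      · exact .inl ⟨hx, hz⟩
      · exact (hy j hy').elim
    · obtain h | ⟨hy', hz⟩ | ⟨j, hy', hz, d'⟩ := h'.eq_cases
      · exact of_bot h fΔ
      · exact (hy' i hy).elim
      · obtain rfl := hy.unique hy'
        exact eq_of_proves hx hz (proves_eq_trans (mono hΔ) hx hy hz d d')
  | relCongr r x y =>
    intro Δ hΔ fΔ h Θ hΘ fΘ hr
    obtain hb | ⟨hs, he⟩ := eqs h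
    · exact of_bot (.weaken hΘ hb) fΘ
    cases r with
    | old r =>
      by_cases w : L.WellSorted (.rel r fun k => ρ (x k))
      · obtain ⟨a, ha, hx⟩ := id w
        refine ⟨fun _ => ?_, fun w' => (w' ⟨a, ha, fun k => (hs k _).1 (hx k)⟩).elim⟩
        exact proves_relCongr (mono (hΔ.trans hΘ)) ha hx (fun k => (hs k _).1 (hx k))
          (fun k => .weaken hΘ (he k _ (hx k))) (hr.1 w)
      · exact of_bot (hr.2 w) fΘ
    | Q i => exact Or.imp (hs 0 i).1 id hr
  | funCongr f x y =>
    intro Δ hΔ fΔ h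
    obtain hb | ⟨hs, he⟩ := eqs h
    · exact of_bot hb fΔ
    by_cases hu : L.Unsorted (.app f fun k => ρ (x k))
    · refine .inl ⟨hu, fun i hi => ?_⟩
      cases hi with
      | app hts hf => exact hu i (.app (fun k => (hs k _).2 (hts k)) hf)
    · obtain ⟨i, hi⟩ := not_unsorted hu
      cases id hi with
      | @app _ _ _ a _ hts hf =>
        have hts' := fun k => (hs k _).1 (hts k)
        exact eq_of_proves hi (.app hts' hf)
          (proves_funCongr (mono hΔ) hf hts hts' fun k => he k _ (hts k))

theorem sortAxiom {A : L.StarFormula} (h : L.SortAxiom A) : Force m A ρ Γ := by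
  cases h with
  | nonempty i x =>
    obtain ⟨z, hz, -⟩ := L.exists_fresh i ∅
    exact .of_self fun Δ _ => ⟨.var z, .inl (by simpa [Term.bind] using .var hz)⟩
  | rank f a i h x =>
    intro Δ hΔ fΔ hx
    by_cases hb : L.Proves m Δ .bot
    · exact of_bot hb fΔ
    · exact .inl (.app (fun k => (hx.bigAnd k).resolve_right hb) h)

/-- On well-sorted formulas, forcing of the translation is derivability. -/
theorem star_iff {A B : Formula L.Fun L.Rel} (hA : L.WellSorted A) (hρ : L.Respects ρ)
    (h : L.Inst ρ A B) (hΓ : FinFree Γ) : Force m (L.star A) ρ Γ ↔ L.Proves m Γ B := by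
  have hB := h.wellSorted hρ hA
  induction A generalizing ρ Γ B with
  | bot => cases h; exact Iff.rfl
  | eq s t =>
    cases h
    obtain ⟨i, hs, -⟩ := id hB
    exact ⟨fun h => (h.resolve_left fun h => h.1 i hs).1 hB,
      fun h => .inr ⟨fun _ => h, fun w => (w hB).elim⟩⟩
  | rel r ts =>
    cases h
    exact ⟨fun h => h.1 hB, fun h => ⟨fun _ => h, fun w => (w hB).elim⟩⟩
  | and A₁ A₂ ih₁ ih₂ =>
    cases h with | and h₁ h₂ =>
    have e₁ := ih₁ hA.1 hρ h₁ hΓ hB.1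
    have e₂ := ih₂ hA.2 hρ h₂ hΓ hB.2
    exact ⟨fun h => .andI (e₁.1 h.1) (e₂.1 h.2), fun h => ⟨e₁.2 h.andE₁, e₂.2 h.andE₂⟩⟩
  | or A₁ A₂ ih₁ ih₂ =>
    cases h with | @or _ _ B₁ _ B₂ h₁ h₂ =>
    constructor
    · refine fun h => h Γ subset_rfl hΓ _ hB fun Δ _ fΔ p => p.elim (fun p => ?_) fun p => ?_
      · exact .orI₁ hB.2 ((ih₁ hA.1 hρ h₁ fΔ hB.1).1 p)
      · exact .orI₂ hB.1 ((ih₂ hA.2 hρ h₂ fΔ hB.2).1 p)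
    -- The two extensions of `Δ` by a disjunct together cover `Δ`, by disjunction elimination
    -- towards `E`.
    · refine fun d Δ hΔ fΔ E _ p => .orE (.weaken hΔ d)
        (p (insert B₁ Δ) (Set.subset_insert _ _) (fΔ.insert _) (.inl ?_))
        (p (insert B₂ Δ) (Set.subset_insert _ _) (fΔ.insert _) (.inr ?_))
      · exact (ih₁ hA.1 hρ h₁ (fΔ.insert _) hB.1).2 (.assumption (by simp) hB.1)
      · exact (ih₂ hA.2 hρ h₂ (fΔ.insert _) hB.2).2 (.assumption (by simp) hB.2)
  | imp A₁ A₂ ih₁ ih₂ =>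
    cases h with | @imp _ _ B₁ _ B₂ h₁ h₂ =>
    constructor
    · refine fun h => .impI hB.1 ((ih₂ hA.2 hρ h₂ (hΓ.insert _) hB.2).1
        (h _ (Set.subset_insert _ _) (hΓ.insert _) ?_))
      exact (ih₁ hA.1 hρ h₁ (hΓ.insert _) hB.1).2 (.assumption (by simp) hB.1)
    · exact fun d Δ hΔ fΔ p => (ih₂ hA.2 hρ h₂ fΔ hB.2).2
        (.impE (.weaken hΔ d) ((ih₁ hA.1 hρ h₁ fΔ hB.1).1 p))
  | all x A ih =>
    obtain ⟨⟨i, hi⟩, hA'⟩ := id hA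
    simp only [star, hi]
    constructor
    · intro hF
      -- A fresh variable of sort `i` is itself an element of the domain satisfying `Q_i`; forcing
      -- at this generic element permits generalization.
      obtain ⟨z, hz, hzV, hzΓ⟩ :=
        hΓ.exists_fresh i ((Formula.all x A).fv.biUnion fun y => (ρ y).vars)
      simp only [Finset.mem_biUnion, not_exists, not_and] at hzV
      obtain ⟨C, hC, -⟩ := Inst.exists_freeFor hA' (update ρ x (.var z)) ∅
      have hρ' := hρ.update hi (.var hz)
      have wC := hC.wellSorted hρ' hA'
      have d := (ih hA' hρ' hC hΓ wC).1 (hF (.var z) Γ subset_rfl hΓ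
        (.inl (by simpa [Term.bind] using .var hz)))
      exact (Inst.all (hz.trans hi.symm) hzV hC).proves h hρ hA (.allI ⟨⟨i, hz⟩, wC⟩ hzΓ d)
    · rintro d t Δ hΔ fΔ (ht | ht)
      · replace ht : L.HasSort t i := by simpa [Term.bind] using ht
        obtain ⟨C, hC, -⟩ := Inst.exists_freeFor hA' (update ρ x t) ∅
        have hρ' := hρ.update hi ht
        exact (ih hA' hρ' hC fΔ (hC.wellSorted hρ' hA')).2
          (h.proves_all_elim hC hρ hA' hi ht (.weaken hΔ d))
      · exact of_bot ht fΔ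
  | ex x A ih =>
    obtain ⟨⟨i, hi⟩, hA'⟩ := id hA
    simp only [star, hi]
    constructor
    · refine fun hF => hF Γ subset_rfl hΓ B hB fun Δ hΔ fΔ => ?_
      rintro ⟨t, ht | ht, p⟩
      · replace ht : L.HasSort t i := by simpa [Term.bind] using ht
        obtain ⟨C, hC, -⟩ := Inst.exists_freeFor hA' (update ρ x t) ∅
        have hρ' := hρ.update hi ht
        exact h.proves_ex_intro hC hρ hA' hi ht
          ((ih hA' hρ' hC fΔ (hC.wellSorted hρ' hA')).1 p)
      · exact .botE hB ht
    · intro d Δ hΔ fΔ E hE p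
      -- The world `Δ` together with the matrix at a fresh `z` has `z` as a witness; freshness for
      -- `E` and `Δ` allows existential elimination.
      obtain ⟨z, hz, hzV, hzΔ⟩ :=
        fΔ.exists_fresh i (E.fv ∪ (Formula.ex x A).fv.biUnion fun y => (ρ y).vars)
      simp only [Finset.mem_union, not_or, Finset.mem_biUnion, not_exists, not_and] at hzV
      obtain ⟨C, hC, -⟩ := Inst.exists_freeFor hA' (update ρ x (.var z)) ∅
      have hρ' := hρ.update hi (.var hz)
      have wC := hC.wellSorted hρ' hA'
      refine .exE hzΔ hzV.1
        (h.proves (Inst.ex (hz.trans hi.symm) hzV.2 hC) hρ hA (.weaken hΔ d))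
        (p _ (Set.subset_insert _ _) (fΔ.insert _) ⟨.var z, .inl ?_, ?_⟩)
      · simpa [Term.bind] using .var hz
      · exact (ih hA' hρ' hC (fΔ.insert _) wC).2 (.assumption (by simp) wC)

end Force

/-- Conservativity of the relativized unsorted theory. -/
theorem mslProves_of_folProves {Γ : Set (Formula L.Fun L.Rel)} {φ : Formula L.Fun L.Rel}
    (hΓ : ∀ ψ ∈ Γ, L.IsSentence ψ) (hφ : L.IsSentence φ)
    (h : FOLProves m (L.star '' Γ ∪ L.J) (L.star φ)) : L.MSLProves m Γ φ := by
  have hfin : FinFree (Γ ∪ univClosure '' {B | L.EqAxiom B}) := by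
    refine Set.finite_empty.subset ?_
    rintro x ⟨B, hB | ⟨B, -, rfl⟩, hx⟩
    · simp [(hΓ B hB).2] at hx
    · simp at hx
  refine (Force.star_iff hφ.1 respects_var (.refl φ) hfin).1 (Force.sound h hfin ?_)
  rintro B ((⟨ψ, hψ, rfl⟩ | ⟨B, hB, rfl⟩) | ⟨B, hB, rfl⟩)
  · exact (Force.star_iff (hΓ ψ hψ).1 respects_var (.refl ψ) hfin).2
      (.assumption (.inl hψ) (hΓ ψ hψ).1)
  · exact Force.univClosure fun ρ => Force.sortAxiom hB
  · exact Force.univClosure fun ρ => Force.eqAxiom Set.subset_union_right hB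

end Signature

/-! ### Unsorted logic as the one-sorted case -/

/-- `FOLDerives m Γ A`: unsorted derivability without equality axioms. -/
abbrev FOLDerives {F : ℕ → Type u} {R : ℕ → Type v} (m : Mode) (Γ : Set (Formula F R))
    (A : Formula F R) : Prop :=
  Derives m (fun _ => True) (fun _ _ => True) Γ A

section Unsorted

variable (F : ℕ → Type u) (R : ℕ → Type v)

/-- An unsorted signature as a many-sorted signature with a single sort. -/
abbrev oneSorted : Signature.{u, v, 0} where
  Fun := F
  Rel := R
  Srt := Unit
  srt_nonempty := ⟨()⟩
  varSort _ := some ()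
  var_infinite _ := by simpa using Set.infinite_univ
  relRank _ := Set.univ
  relRank_nonempty _ := Set.univ_nonempty
  funRank _ _ := some ()
  funRank_nonempty _ := ⟨fun _ => (), (), rfl⟩

variable {F R}

theorem oneSorted_hasSort (t : Term F) : (oneSorted F R).HasSort t () := by
  induction t with
  | var x => exact .var rfl
  | app f ts ih => exact .app (a := fun _ => ()) ih rfl

theorem oneSorted_wellSorted (A : Formula F R) : (oneSorted F R).WellSorted A := by
  induction A with
  | bot => trivial
  | eq s t => exact ⟨(), oneSorted_hasSort s, oneSorted_hasSort t⟩
  | rel r ts => exact ⟨fun _ => (), trivial, fun k => oneSorted_hasSort (ts k)⟩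
  | and A B ihA ihB | or A B ihA ihB | imp A B ihA ihB => exact ⟨ihA, ihB⟩
  | all x A ih | ex x A ih => exact ⟨⟨(), rfl⟩, ih⟩

/-- With one sort, both side conditions of the calculus are vacuous; the results on instances thus
transfer to unsorted derivations. -/
theorem oneSorted_proves_iff {m : Mode} {Γ : Set (Formula F R)} {A : Formula F R} :
    (oneSorted F R).Proves m Γ A ↔ FOLDerives m Γ A := by
  have hW : (oneSorted F R).WellSorted = fun _ => True :=
    funext fun A => eq_true (oneSorted_wellSorted A)
  have hT : (fun x t => ∃ i, (oneSorted F R).varSort x = some i ∧ (oneSorted F R).HasSort t i) =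
      fun _ _ => True := by
    funext x t
    exact eq_true ⟨(), rfl, oneSorted_hasSort t⟩
  rw [Signature.Proves, hW, hT]

theorem FOLDerives.of_univClosure {m : Mode} {Γ : Set (Formula F R)} {A B : Formula F R}
    {σ : ℕ → Term F} (d : FOLDerives m Γ A.univClosure) (h : (oneSorted F R).Inst σ A B) :
    FOLDerives m Γ B :=
  oneSorted_proves_iff.1 (Signature.Proves.of_univClosure (oneSorted_proves_iff.2 d)
    (oneSorted_wellSorted A) (fun x _ _ => oneSorted_hasSort (σ x)) h)

theorem FOLDerives.of_univClosure_self {m : Mode} {Γ : Set (Formula F R)} {A : Formula F R}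
    (d : FOLDerives m Γ A.univClosure) : FOLDerives m Γ A :=
  FOLDerives.of_univClosure d (Signature.Inst.refl (L := oneSorted F R) A)

end Unsorted

/-! ### Translating many-sorted derivations -/

namespace Signature

variable {L : Signature.{u, v, w}} {m : Mode}

theorem fv_star (A : Formula L.Fun L.Rel) : (L.star A).fv = A.fv := by
  induction A with
  | bot | eq | rel => rfl
  | and A B ihA ihB | or A B ihA ihB | imp A B ihA ihB => simp [star, fv, ihA, ihB]
  | all x A ih | ex x A ih =>
    cases h : L.varSort x
    · simp [star, h, fv, ih]
    · ext y
      simp only [star, h, fv, ih, sortPred, Term.vars, Finset.mem_erase, Finset.mem_union,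
        Finset.mem_biUnion, Finset.mem_univ, true_and, Finset.mem_singleton, exists_const]
      tauto

theorem star_subst (A : Formula L.Fun L.Rel) (x : ℕ) (t : Term L.Fun) :
    L.star (A.subst x t) = (L.star A).subst x t := by
  induction A with
  | bot | eq | rel => rfl
  | and A B ihA ihB | or A B ihA ihB | imp A B ihA ihB => simp [star, Formula.subst, ihA, ihB]
  | all y A ih | ex y A ih =>
    by_cases e : y = x <;> cases h : L.varSort y <;>
      simp_all [star, Formula.subst, sortPred, Term.subst]

theorem star_freeFor {A : Formula L.Fun L.Rel} {x : ℕ} {t : Term L.Fun} (h : A.FreeFor x t) :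
    (L.star A).FreeFor x t := by
  induction A with
  | bot | eq | rel => trivial
  | and A B ihA ihB | or A B ihA ihB | imp A B ihA ihB => exact ⟨ihA h.1, ihB h.2⟩
  | all y A ih =>
    have hfv := fv_star (L := L) (.all y A)
    cases hy : L.varSort y <;> simp only [star, hy] at hfv ⊢ <;> intro hx <;>
      obtain ⟨h₁, h₂⟩ := h (hfv ▸ hx)
    exacts [⟨h₁, ih h₂⟩, ⟨h₁, trivial, ih h₂⟩]
  | ex y A ih =>
    have hfv := fv_star (L := L) (.ex y A)
    cases hy : L.varSort y <;> simp only [star, hy] at hfv ⊢ <;> intro hx <;>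
      obtain ⟨h₁, h₂⟩ := h (hfv ▸ hx)
    exacts [⟨h₁, ih h₂⟩, ⟨h₁, trivial, ih h₂⟩]

theorem star_conj {ι : Type*} (A : ι → Formula L.Fun L.Rel) :
    ∀ l : List ι, L.star (conj (l.map A)) = conj (l.map fun k => L.star (A k))
  | [] => rfl
  | [_] => rfl
  | k :: k' :: l => congrArg (Formula.and (L.star (A k))) (star_conj A (k' :: l))

theorem star_bigAnd {n : ℕ} (A : Fin n → Formula L.Fun L.Rel) :
    L.star (bigAnd A) = bigAnd fun k => L.star (A k) := by
  rw [bigAnd_eq, bigAnd_eq, star_conj]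

theorem EqAxiom.star {A : Formula L.Fun L.Rel} (h : L.EqAxiom A) : FOLEqAxiom (L.star A) := by
  cases h with
  | refl x => exact .refl x
  | symm x y => exact .symm x y
  | trans x y z => exact .trans x y z
  | relCongr r a ha x y =>
    simp only [Signature.star, star_bigAnd]
    exact .relCongr (StarRel.old r) x y
  | funCongr f a i ha x y =>
    simp only [Signature.star, star_bigAnd]
    exact .funCongr f x y

/-- The assumptions `Q_i x` for the variables `x` in `S`. -/
def sortHyps (L : Signature.{u, v, w}) (S : Finset ℕ) : Set L.StarFormula :=
  {B | ∃ x ∈ S, ∃ i, L.varSort x = some i ∧ B = L.sortPred i (.var x)}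

theorem sortHyps_mono {S S' : Finset ℕ} (h : S ⊆ S') : L.sortHyps S ⊆ L.sortHyps S' :=
  fun _ ⟨x, hx, hB⟩ => ⟨x, h hx, hB⟩

theorem fv_sortPred_var (i : L.Srt) (x : ℕ) : (L.sortPred i (.var x)).fv = {x} := by
  simp [sortPred, fv, Term.vars]

theorem notMem_fv_of_sortHyps {S : Finset ℕ} {x : ℕ} (hx : x ∉ S) {B : L.StarFormula}
    (hB : B ∈ L.sortHyps S) : x ∉ B.fv := by
  obtain ⟨y, hy, i, -, rfl⟩ := hB
  rw [fv_sortPred_var, Finset.mem_singleton]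
  rintro rfl
  exact hx hy

theorem sortHyps_subset_insert {S : Finset ℕ} {x : ℕ} {i : L.Srt} (hx : L.varSort x = some i) :
    L.sortHyps S ⊆ insert (L.sortPred i (.var x)) (L.sortHyps (S.erase x)) := by
  rintro B ⟨y, hy, j, hj, rfl⟩
  by_cases e : y = x
  · subst e
    exact .inl (by rw [Option.some.inj (hj.symm.trans hx)])
  · exact .inr ⟨y, by simp [e, hy], j, hj, rfl⟩

theorem sortHyps_erase_of_none {S : Finset ℕ} {x : ℕ} (hx : L.varSort x = none) :
    L.sortHyps S ⊆ L.sortHyps (S.erase x) := by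
  rintro B ⟨y, hy, j, hj, rfl⟩
  refine ⟨y, Finset.mem_erase.2 ⟨?_, hy⟩, j, hj, rfl⟩
  rintro rfl
  simp [hx] at hj

section Translation

variable {Δ : Set L.StarFormula}

theorem derives_sortPred_app (hJ : L.J ⊆ Δ) {n : ℕ} {f : L.Fun n} {a : Fin n → L.Srt} {i : L.Srt}
    (hf : L.funRank f a = some i) {ts : Fin n → Term L.Fun}
    (h : ∀ k, FOLDerives m Δ (L.sortPred (a k) (ts k))) :
    FOLDerives m Δ (L.sortPred i (.app f ts)) := by
  -- The rank axiom is taken at the variables `0, …, n - 1`, whose own sorts are irrelevant in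
  -- unsorted logic.
  let σ (y : ℕ) : Term L.Fun := if hy : y < n then ts ⟨y, hy⟩ else .var y
  have hσ (k : Fin n) : σ k = ts k := by simp [σ]
  have d : FOLDerives m Δ (imp (bigAnd fun k => L.sortPred (a k) (.var (k : ℕ)))
      (L.sortPred i (.app f fun k => .var (k : ℕ)))).univClosure :=
    .assumption (hJ ⟨_, .rank f a i hf fun k => k, rfl⟩) trivial
  have d' := FOLDerives.of_univClosure (σ := σ) d (.imp (.bigAnd fun k => .rel _ _) (.rel _ _))
  simp only [Term.bind, hσ] at d'
  exact d'.impE (.bigAnd trivial h)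

theorem HasSort.derives_sortPred (hJ : L.J ⊆ Δ) {t : Term L.Fun} {i : L.Srt} (ht : L.HasSort t i)
    (h : L.sortHyps t.vars ⊆ Δ) : FOLDerives m Δ (L.sortPred i t) := by
  induction ht with
  | var hx => exact .assumption (h ⟨_, by simp [Term.vars], _, hx, rfl⟩) trivial
  | app hts hf ih =>
    refine derives_sortPred_app hJ hf fun k => ih k ((sortHyps_mono fun x hx => ?_).trans h)
    simp only [Term.vars, Finset.mem_biUnion]
    exact ⟨k, by simp, hx⟩

/-- The hypothesis `Q_i x` is removed by existential elimination on the axiom `∃ x, Q_i x`; a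
variable without a sort carries no hypothesis. -/
theorem derives_erase (hJ : L.J ⊆ Δ) {S : Finset ℕ} {x : ℕ} {A : L.StarFormula}
    (hx : ∀ B ∈ Δ, x ∉ B.fv) (hA : x ∉ A.fv) (d : FOLDerives m (Δ ∪ L.sortHyps S) A) :
    FOLDerives m (Δ ∪ L.sortHyps (S.erase x)) A := by
  cases h : L.varSort x with
  | none => exact .weaken (Set.union_subset_union_right _ (sortHyps_erase_of_none h)) d
  | some i =>
    have d₀ : FOLDerives m (Δ ∪ L.sortHyps (S.erase x)) (.ex x (L.sortPred i (.var x))) :=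
      FOLDerives.of_univClosure_self
        (.assumption (.inl (hJ ⟨_, .nonempty i x, rfl⟩)) trivial)
    refine .exE ?_ hA d₀ (.weaken ?_ d)
    · rintro B (hB | hB)
      exacts [hx B hB, notMem_fv_of_sortHyps (by simp) hB]
    · rw [← Set.union_insert]
      exact Set.union_subset_union_right _ (sortHyps_subset_insert h)

theorem derives_of_sortHyps (hJ : L.J ⊆ Δ) (hΔ : ∀ B ∈ Δ, B.fv = ∅) {A : L.StarFormula}
    (hA : A.fv = ∅) {S : Finset ℕ} (d : FOLDerives m (Δ ∪ L.sortHyps S) A) : FOLDerives m Δ A := by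
  induction S using Finset.induction_on with
  | empty => exact .weaken (by rintro B (hB | ⟨x, hx, -⟩); exacts [hB, by simp at hx]) d
  | insert x S hx ih =>
    refine ih ?_
    have := derives_erase (x := x) hJ (fun B hB => by simp [hΔ B hB]) (by simp [hA]) d
    rwa [Finset.erase_insert hx] at this

/-- Needed because the translation of a universal closure is relativized: it is not the universal
closure of the translation, but follows from it. -/
theorem derives_star_foldr_all (hΔ : ∀ B ∈ Δ, B.fv = ∅) {A : Formula L.Fun L.Rel}
    (d : FOLDerives m Δ (L.star A)) (l : List ℕ) : FOLDerives m Δ (L.star (l.foldr .all A)) := by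
  induction l with
  | nil => exact d
  | cons x l ih =>
    have hx : ∀ B ∈ Δ, x ∉ B.fv := fun B hB => by simp [hΔ B hB]
    simp only [List.foldr_cons, star]
    split
    · exact .allI trivial hx (.impI trivial (.weaken (Set.subset_insert _ _) ih))
    · exact .allI trivial hx ih

/-- The translations of the assumptions outside `E`, together with a theory `Θ` and sort assumptions
for the variables in `S`. -/
def starContext (Θ : Set L.StarFormula) (E Γ : Set (Formula L.Fun L.Rel)) (S : Finset ℕ) :
    Set L.StarFormula :=
  Θ ∪ L.star '' (Γ \ E) ∪ L.sortHyps S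

variable {Θ : Set L.StarFormula} {E Γ Γ' : Set (Formula L.Fun L.Rel)} {S S' : Finset ℕ}

theorem starContext_mono (hΓ : Γ ⊆ Γ') (hS : S ⊆ S') :
    starContext Θ E Γ S ⊆ starContext Θ E Γ' S' :=
  Set.union_subset_union (Set.union_subset_union_right _ (Set.image_mono
    (Set.sdiff_subset_sdiff_left hΓ))) (sortHyps_mono hS)

theorem starContext_insert (A : Formula L.Fun L.Rel) (hS : S ⊆ S') :
    starContext Θ E (insert A Γ) S ⊆ insert (L.star A) (starContext Θ E Γ S') := by
  rintro B ((hB | ⟨C, ⟨rfl | hC, hE⟩, rfl⟩) | hB)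
  exacts [.inr (.inl (.inl hB)), .inl rfl, .inr (.inl (.inr ⟨C, ⟨hC, hE⟩, rfl⟩)),
    .inr (.inr (sortHyps_mono hS hB))]

theorem starContext_fresh (hΘ : ∀ B ∈ Θ, B.fv = ∅) {x : ℕ} (hΓ : ∀ B ∈ Γ, x ∉ B.fv) :
    ∀ B ∈ Θ ∪ L.star '' (Γ \ E), x ∉ B.fv := by
  rintro B (hB | ⟨C, hC, rfl⟩)
  · simp [hΘ B hB]
  · rw [fv_star]
    exact hΓ C hC.1

theorem starContext_erase_fresh (hΘ : ∀ B ∈ Θ, B.fv = ∅) {x : ℕ} (hΓ : ∀ B ∈ Γ, x ∉ B.fv) :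
    ∀ B ∈ starContext Θ E Γ (S.erase x), x ∉ B.fv := by
  rintro B (hB | hB)
  exacts [starContext_fresh hΘ hΓ B hB, notMem_fv_of_sortHyps (by simp) hB]

/-- Many-sorted derivations translate to unsorted ones from finitely many sort assumptions. -/
theorem Proves.star (hJ : L.J ⊆ Θ) (hΘ : ∀ B ∈ Θ, B.fv = ∅)
    (hE : ∀ B ∈ E, FOLDerives m Θ (L.star B)) {A : Formula L.Fun L.Rel} (d : L.Proves m Γ A) :
    ∃ S, FOLDerives m (starContext Θ E Γ S) (L.star A) := by
  have hJ' {Γ S} : L.J ⊆ starContext Θ E Γ S :=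
    fun B hB => .inl (.inl (hJ hB))
  have mono {Γ : Set (Formula L.Fun L.Rel)} {S S' : Finset ℕ} {A : L.StarFormula} (hS : S ⊆ S')
      (d : FOLDerives m (starContext Θ E Γ S) A) : FOLDerives m (starContext Θ E Γ S') A :=
    .weaken (starContext_mono subset_rfl hS) d
  induction d with
  | @assumption Γ A hA _ =>
    refine ⟨∅, ?_⟩
    -- Here `E` will be the many-sorted equality axioms: their translations are derived from `Θ` at
    -- the leaves instead of being kept as assumptions.
    by_cases h : A ∈ E
    · exact .weaken (fun B hB => .inl (.inl hB)) (hE A h)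
    · exact .assumption (.inl (.inr ⟨A, ⟨hA, h⟩, rfl⟩)) trivial
  | weaken hs _ ih =>
    obtain ⟨S, d⟩ := ih
    exact ⟨S, .weaken (starContext_mono hs subset_rfl) d⟩
  | andI _ _ ih₁ ih₂ =>
    obtain ⟨S₁, d₁⟩ := ih₁
    obtain ⟨S₂, d₂⟩ := ih₂
    exact ⟨S₁ ∪ S₂, .andI (mono (by simp) d₁) (mono (by simp) d₂)⟩
  | andE₁ _ ih => exact ih.imp fun _ d => d.andE₁
  | andE₂ _ ih => exact ih.imp fun _ d => d.andE₂
  | orI₁ _ _ ih => exact ih.imp fun _ d => d.orI₁ trivial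
  | orI₂ _ _ ih => exact ih.imp fun _ d => d.orI₂ trivial
  | orE _ _ _ ih ih₁ ih₂ =>
    obtain ⟨S, d⟩ := ih
    obtain ⟨S₁, d₁⟩ := ih₁
    obtain ⟨S₂, d₂⟩ := ih₂
    exact ⟨S ∪ (S₁ ∪ S₂), .orE (mono Finset.subset_union_left d)
      (.weaken (starContext_insert _ (by grind)) d₁)
      (.weaken (starContext_insert _ (by grind)) d₂)⟩
  | impI _ _ ih =>
    exact ih.imp fun _ d => .impI trivial (.weaken (starContext_insert _ subset_rfl) d)
  | impE _ _ ih₁ ih₂ =>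
    obtain ⟨S₁, d₁⟩ := ih₁
    obtain ⟨S₂, d₂⟩ := ih₂
    exact ⟨S₁ ∪ S₂, .impE (mono (by simp) d₁) (mono (by simp) d₂)⟩
  | botE _ _ ih => exact ih.imp fun _ d => d.botE trivial
  | raa hm _ _ ih =>
    exact ih.imp fun _ d => .raa hm trivial (.weaken (starContext_insert _ subset_rfl) d)
  | @allI Γ x A _ hx _ ih =>
    obtain ⟨S, d⟩ := ih
    refine ⟨S.erase x, ?_⟩
    cases h : L.varSort x with
    | none =>
      simp only [Signature.star, h]
      exact .allI trivial (starContext_erase_fresh hΘ hx)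
        (.weaken (Set.union_subset_union_right _ (sortHyps_erase_of_none h)) d)
    | some i =>
      simp only [Signature.star, h]
      -- The hypothesis `Q_i x`, which would violate the eigenvariable condition, is discharged as
      -- the relativizing antecedent.
      refine .allI trivial (starContext_erase_fresh hΘ hx) (.impI trivial (.weaken ?_ d))
      rw [starContext, starContext, ← Set.union_insert]
      exact Set.union_subset_union_right _ (sortHyps_subset_insert h)
  | @allE Γ x A t ht hf _ ih =>
    obtain ⟨S, d⟩ := ih
    obtain ⟨i, hx, ht⟩ := ht
    simp only [Signature.star, hx] at d
    refine ⟨S ∪ t.vars, ?_⟩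
    -- The variables of `t` join `S` because they need not occur in the conclusion, yet `Q_i t` has
    -- to be derived.
    have hf' : (imp (L.sortPred i (.var x)) (L.star A)).FreeFor x t := ⟨trivial, star_freeFor hf⟩
    have d' := Derives.allE (t := t) trivial hf'
      (mono (S' := S ∪ t.vars) (by simp) d)
    rw [star_subst]
    refine Derives.impE d' ?_
    simpa [Formula.subst, sortPred, Term.subst] using
      ht.derives_sortPred (m := m) (hJ' (Γ := Γ) (S := S ∪ t.vars))
        fun B hB => .inr (sortHyps_mono (by simp) hB)
  | @exI Γ x A t _ ht hf _ ih =>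
    obtain ⟨S, d⟩ := ih
    obtain ⟨i, hx, ht⟩ := ht
    refine ⟨S ∪ t.vars, ?_⟩
    simp only [Signature.star, hx]
    refine .exI (t := t) trivial trivial ⟨trivial, star_freeFor hf⟩ (.andI ?_ ?_)
    · simpa [Formula.subst, sortPred, Term.subst] using
        ht.derives_sortPred (m := m) (hJ' (Γ := Γ) (S := S ∪ t.vars))
          fun B hB => .inr (sortHyps_mono (by simp) hB)
    · rw [← star_subst]
      exact mono (by simp) d
  | @exE Γ x A C hx hC _ _ ih ih₁ =>
    obtain ⟨S, d⟩ := ih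
    obtain ⟨S₁, d₁⟩ := ih₁
    refine ⟨(S ∪ S₁).erase x, ?_⟩
    have hfv : x ∉ (L.star (.ex x A)).fv := by rw [fv_star]; simp [fv]
    have hC' : x ∉ (L.star C).fv := by rwa [fv_star]
    -- The derivation of the existential premise may itself use `Q_i x`; this is removed first,
    -- since `x` must not be free in the context of the elimination.
    have d' := derives_erase (fun B hB => .inl (hJ hB)) (starContext_fresh (E := E) hΘ hx) hfv
      (mono (S' := S ∪ S₁) (by simp) d)
    have fresh := starContext_erase_fresh (E := E) (S := S ∪ S₁) hΘ hx
    have d₁' := Derives.weaken (starContext_insert A (S' := S ∪ S₁) (by simp)) d₁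
    cases h : L.varSort x with
    | none =>
      simp only [Signature.star, h] at d'
      exact .exE fresh hC' d' (.weaken (Set.insert_subset_insert
        (Set.union_subset_union_right _ (sortHyps_erase_of_none h))) d₁')
    | some i =>
      simp only [Signature.star, h] at d'
      refine .exE fresh hC' d' ?_
      have hQ : FOLDerives m (insert (.and (L.sortPred i (.var x)) (L.star A))
          (starContext Θ E Γ ((S ∪ S₁).erase x))) (.and (L.sortPred i (.var x)) (L.star A)) :=
        .assumption (by simp) trivial
      refine .impE (.impE (.impI trivial (.impI trivial (.weaken ?_ d₁'))) hQ.andE₂) hQ.andE₁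
      rintro B (rfl | hB | hB)
      · exact .inr (.inl rfl)
      · exact .inr (.inr (.inr (.inl hB)))
      · obtain rfl | hB := sortHyps_subset_insert h hB
        exacts [.inl rfl, .inr (.inr (.inr (.inr hB)))]

end Translation

/-- Many-sorted derivability is preserved by the translation. -/
theorem folProves_of_mslProves {Γ : Set (Formula L.Fun L.Rel)} {φ : Formula L.Fun L.Rel}
    (hΓ : ∀ ψ ∈ Γ, L.IsSentence ψ) (hφ : L.IsSentence φ) (h : L.MSLProves m Γ φ) :
    FOLProves m (L.star '' Γ ∪ L.J) (L.star φ) := by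
  let Θ : Set L.StarFormula := L.J ∪ univClosure '' {B | FOLEqAxiom B}
  have hΘ : ∀ B ∈ Θ, B.fv = ∅ := by
    rintro B (⟨B, -, rfl⟩ | ⟨B, -, rfl⟩) <;> simp
  have hE : ∀ B ∈ univClosure '' {B | L.EqAxiom B}, FOLDerives m Θ (L.star B) := by
    rintro _ ⟨B, hB, rfl⟩
    exact derives_star_foldr_all hΘ
      (FOLDerives.of_univClosure_self (.assumption (.inr ⟨_, hB.star, rfl⟩) trivial)) _
  obtain ⟨S, d⟩ := Proves.star Set.subset_union_left hΘ hE h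
  refine .weaken ?_ (derives_of_sortHyps (fun B hB => .inl (.inl hB)) ?_ ?_ d)
  · rintro B ((hB | hB) | ⟨C, ⟨hC | hC, hn⟩, rfl⟩)
    exacts [.inl (.inr hB), .inr hB, .inl (.inl ⟨C, hC, rfl⟩), (hn hC).elim]
  · rintro B (hB | ⟨C, ⟨hC | hC, hn⟩, rfl⟩)
    exacts [hΘ B hB, by rw [fv_star, (hΓ C hC).2], (hn hC).elim]
  · rw [fv_star, hφ.2]

end Signature

end ManySorted

theorem theorem4p2 (L : ManySorted.Signature) (m : ManySorted.Mode)
    (Γ : Set (ManySorted.Formula L.Fun L.Rel)) (φ : ManySorted.Formula L.Fun L.Rel)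
    (hΓ : ∀ ψ ∈ Γ, L.IsSentence ψ) (hφ : L.IsSentence φ) :
    L.MSLProves m Γ φ ↔ ManySorted.FOLProves m (L.star '' Γ ∪ L.J) (L.star φ) :=
  ⟨ManySorted.Signature.folProves_of_mslProves hΓ hφ,
    ManySorted.Signature.mslProves_of_folProves hΓ hφ⟩
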